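/- Let $H$ be a (real or complex) Hilbert space, $\mathcal L(H)$ the bounded linear operators on $H$ with operator norm $\|\cdot\|_{op}$, $T>0$, $\alpha\in(0,1)$, $\eta\in[0,1)$ with $\rho:=\alpha-\eta>0$, and $\Delta_n^T=\{(s_1,\dots,s_n)\in[0,T]^n: s_1\ge\dots\ge s_n\}$. For a two-parameter function $f$ write $\square_{(s,s'),(t,t')}f=f(t,t')-f(t,s')-f(s,t')+f(s,s')$. Negative powers of $0$ are read as $+\infty$ (with $x/\infty=0$, and $0/0=0\cdot\infty=0$); a bound whose right-hand side is $+\infty$ says nothing. A Volterra kernel $K\in\mathcal K_\eta$ is a map $K:\Delta_2^T\to\mathcal L(H)$ with $\|K\|_{\mathcal K_\eta}:=\|K\|_{\eta,1}+\|K\|_{\eta,2}+\|K\|_{\eta,3}+\|K\|_{\eta,4}<\infty$, where $$\|K\|_{\eta,1}=\sup_{(t,s)\in\Delta_2^T}\frac{\|K(t,s)\|_{op}}{|t-s|^{-\eta}},\qquad \|K\|_{\eta,2}=\sup_{(t,u,s)\in\Delta_3^T,\ \theta\in[0,1]}\frac{\|K(t,s)-K(u,s)\|_{op}}{|t-u|^{\theta}|u-s|^{-\theta-\eta}},$$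 $$\|K\|_{\eta,3}=\sup_{(t,u,s)\in\Delta_3^T,\ \theta\in[0,1]}\frac{\|K(t,u)-K(t,s)\|_{op}}{|u-s|^{\theta}|t-u|^{-\theta-\eta}},\qquad \|K\|_{\eta,4}=\sup_{(\tau',\tau,s,r)\in\Delta_4^T,\ \theta,\nu\in[0,1]}\frac{\|K(\tau',s)-K(\tau',r)-K(\tau,s)+K(\tau,r)\|_{op}}{|\tau-s|^{-\nu-\theta-\eta}|\tau'-\tau|^{\nu}|s-r|^{\theta}} .$$ An $\alpha$-regular operator function $Q\in\mathcal Q_\alpha$ is a map $Q:[0,T]^2\to\mathcal L(H)$ with $\|Q\|_{\mathcal Q_\alpha}<\infty$, where $\|Q\|_{\mathcal Q_\alpha}$ is the sum of $$\sup_{(t,s)\in\Delta_2^T,\,t'\in[0,T]}\frac{\|Q(t,t')-Q(s,t')\|_{op}}{|t-s|^\alpha},\quad \sup_{t\in[0,T],\,(t',s')\in\Delta_2^T}\frac{\|Q(t,t')-Q(t,s')\|_{op}}{|t'-s'|^\alpha},\quad \sup_{(t,s),(t',s')\in\Delta_2^T}\frac{\|\square_{(s,s'),(t,t')}Q\|_{op}}{(|t-s||t'-s'|)^\alpha}.$$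 For operator functions $F,G$ the integral $\int_s^t\int_{s'}^{t'}F(r)\,d^2Q(r,r')\,G(r')$ denotes the limit in operator norm, as $|\mathcal P|\to0$ and $|\mathcal P'|\to0$, of $\sum_{[u,v]\in\mathcal P,\,[u',v']\in\mathcal P'}F(u)\,\square_{(u,u'),(v,v')}Q\,G(u')$ over partitions $\mathcal P$ of $[s,t]$ and $\mathcal P'$ of $[s',t']$. **Theorem.** There exist $(\beta,\kappa)\in(1,\infty)\times[0,1)$ with $\beta-\kappa\ge\rho$ and a constant $C>0$ such that the following holds for all $K\in\mathcal K_\eta$ and $Q\in\mathcal Q_\alpha$. For all $(\tau,t),(\tau',t')\in\Delta_2^T$ there is a unique operator $\mathcal I^{\tau,\tau'}(t,t')=\int_0^t\int_0^{t'}K(\tau,r)\,d^2Q(r,r')\,K(\tau',r')^*\in\mathcal L(H)$ (that is, the limit exists and is unique), and for $(\tau,v,u),(\tau',v',u')\in\Delta_3^T$ the integral over $[u,v]\times[u',v']$ exists and $$\square_{(u,u'),(v,v')}\mathcal I^{\tau,\tau'}=\int_u^v\int_{u'}^{v'}K(\tau,r)\,d^2Q(r,r')\,K(\tau',r')^* .$$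 Moreover all integrals below exist, and with $M:=C\|K\|_{\mathcal K_\eta}^2\|Q\|_{\mathcal Q_\alpha}$: (i) for $(\tau,t,s),(\tau',t',s')\in\Delta_3^T$, $$\Big\|\int_s^t\!\int_{s'}^{t'}(K(\tau,r)-K(\tau,s))\,d^2Q(r,r')\,(K(\tau',r')^*-K(\tau',s')^*)\Big\|_{op}\le M\Big(\big[|\tau-t||\tau'-t'|\big]^{-\kappa}\big[|t-s||t'-s'|\big]^{\beta}\Big)\wedge\big[|\tau-s||\tau'-s'|\big]^{\beta-\kappa};$$ (ii) for $(\tau,t,s)\in\Delta_3^T$, $(\tau_1',\tau_2',t',s')\in\Delta_4^T$, all $\zeta\in[0,\rho)$ and $\theta\in[\zeta,1]$, $$\Big\|\int_s^t\!\int_{s'}^{t'}(K(\tau,r)-K(\tau,s))\,d^2Q(r,r')\,\square_{(\tau_2',s'),(\tau_1',r')}K^*\Big\|_{op}\le M|\tau_1'-\tau_2'|^\theta|\tau_2'-t'|^{-\theta+\zeta}\Big\{\Big(|\tau-t|^{-\kappa}|\tau_2'-t'|^{-\kappa-\zeta}\big[|t-s||t'-s'|\big]^\beta\Big)\wedge\Big(|\tau-s|^{\beta-\kappa}|\tau_2'-s'|^{\beta-\kappa-\zeta}\Big)\Big\};$$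 (iii) for $(\tau_1,\tau_2,t,s)\in\Delta_4^T$, $(\tau',t',s')\in\Delta_3^T$, all $\zeta\in[0,\rho)$ and $\theta\in[\zeta,1]$, $$\Big\|\int_s^t\!\int_{s'}^{t'}\square_{(\tau_2,s),(\tau_1,r)}K\,d^2Q(r,r')\,(K(\tau',r')^*-K(\tau',s')^*)\Big\|_{op}\le M|\tau_1-\tau_2|^\theta|\tau_2-t|^{-\theta+\zeta}\Big\{\Big(|\tau_2-t|^{-\kappa-\zeta}|\tau'-t'|^{-\kappa}\big[|t-s||t'-s'|\big]^\beta\Big)\wedge\Big(|\tau_2-s|^{\beta-\kappa-\zeta}|\tau'-s'|^{\beta-\kappa}\Big)\Big\};$$ (iv) for $(\tau_1,\tau_2,t,s),(\tau_1',\tau_2',t',s')\in\Delta_4^T$, all $\zeta\in[0,\rho)$ and $\theta\in[\zeta,1]$, $$\Big\|\int_s^t\!\int_{s'}^{t'}\square_{(\tau_2,s),(\tau_1,r)}K\,d^2Q(r,r')\,\square_{(\tau_2',s'),(\tau_1',r')}K^*\Big\|_{op}\le M\big[|\tau_1-\tau_2||\tau_1'-\tau_2'|\big]^\theta\big[|\tau_2-t||\tau_2'-t'|\big]^{-\theta+\zeta}\Big\{\Big(\big[|\tau_2-t||\tau_2'-t'|\big]^{-\kappa-\zeta}\big[|t-s||t'-s'|\big]^\beta\Big)\wedge\big[|\tau_2-s||\tau_2'-s'|\big]^{\beta-\kappa-\zeta}\Big\}.$$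 -/

import Mathlib

open scoped ENNReal NNReal

namespace VolterraSewing

/-- `(t, s)` lies in the simplex `Δ₂ᵀ`, i.e. `T ≥ t ≥ s ≥ 0`. -/
def Simplex2 (T t s : ℝ) : Prop := 0 ≤ s ∧ s ≤ t ∧ t ≤ T

/-- `(τ, t, s)` lies in the simplex `Δ₃ᵀ`, i.e. `T ≥ τ ≥ t ≥ s ≥ 0`. -/
def Simplex3 (T τ t s : ℝ) : Prop := 0 ≤ s ∧ s ≤ t ∧ t ≤ τ ∧ τ ≤ T

/-- `(τ₁, τ₂, t, s)` lies in the simplex `Δ₄ᵀ`, i.e. `T ≥ τ₁ ≥ τ₂ ≥ t ≥ s ≥ 0`. -/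
def Simplex4 (T τ₁ τ₂ t s : ℝ) : Prop := 0 ≤ s ∧ s ≤ t ∧ t ≤ τ₂ ∧ τ₂ ≤ τ₁ ∧ τ₁ ≤ T

/-- The rectangular increment `□_{(s₁,s₂),(t₁,t₂)} f`. -/
def rectInc {E : Type*} [AddCommGroup E] (f : ℝ → ℝ → E) (s₁ s₂ t₁ t₂ : ℝ) : E :=
  f t₁ t₂ - f t₁ s₂ - f s₁ t₂ + f s₁ s₂

/-- A finite partition `a = pt 0 < pt 1 < ⋯ < pt n = b` of the interval `[a, b]`
(the values of `pt` beyond `n` play no role; if `a = b` then `n = 0`). -/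
structure Partition (a b : ℝ) where
  n : ℕ
  pt : ℕ → ℝ
  pt_zero : pt 0 = a
  pt_last : pt n = b
  lt_succ : ∀ i, i < n → pt i < pt (i + 1)

/-- The mesh of the partition is smaller than `δ`. -/
def Partition.MeshLT {a b : ℝ} (P : Partition a b) (δ : ℝ) : Prop :=
  ∀ i, i < P.n → P.pt (i + 1) - P.pt i < δ

section Operators

variable {𝕜 H : Type*} [RCLike 𝕜] [NormedAddCommGroup H] [InnerProductSpace 𝕜 H]

/-- The two-dimensional Riemann sum
`∑_{[u,v] ∈ P, [u',v'] ∈ P'} F(u) ∘ □_{(u,u'),(v,v')} Q ∘ G(u')`. -/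
noncomputable def riemannSum (F : ℝ → H →L[𝕜] H) (Q : ℝ → ℝ → H →L[𝕜] H) (G : ℝ → H →L[𝕜] H)
    {s t s' t' : ℝ} (P : Partition s t) (P' : Partition s' t') : H →L[𝕜] H :=
  ∑ i ∈ Finset.range P.n, ∑ j ∈ Finset.range P'.n,
    (F (P.pt i)).comp
      ((rectInc Q (P.pt i) (P'.pt j) (P.pt (i + 1)) (P'.pt (j + 1))).comp (G (P'.pt j)))

/-- `∫_s^t ∫_{s'}^{t'} F(r) d²Q(r,r') G(r') = I`: the Riemann sums converge to `I` in operator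
norm as the meshes of both partitions tend to zero. -/
def HasDoubleIntegral (F : ℝ → H →L[𝕜] H) (Q : ℝ → ℝ → H →L[𝕜] H) (G : ℝ → H →L[𝕜] H)
    (s t s' t' : ℝ) (I : H →L[𝕜] H) : Prop :=
  ∀ ε : ℝ, 0 < ε → ∃ δ : ℝ, 0 < δ ∧ ∀ (P : Partition s t) (P' : Partition s' t'),
    P.MeshLT δ → P'.MeshLT δ → ‖riemannSum F Q G P P' - I‖ < ε

/-! The semi-norms below take values in `[0, ∞]`.  In `[0, ∞]` a negative power of `0` is `∞` and
`x / ∞ = 0`, so nothing is required where the denominator is singular; where the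
denominator vanishes (or is of the form `0 * ∞ = 0`) the numerator vanishes too, and `0 / 0 = 0`. -/

noncomputable def kernelNorm1 (T η : ℝ) (K : ℝ → ℝ → H →L[𝕜] H) : ℝ≥0∞ :=
  ⨆ (t : ℝ) (s : ℝ) (_ : Simplex2 T t s), ‖K t s‖ₑ / ‖t - s‖ₑ ^ (-η)

noncomputable def kernelNorm2 (T η : ℝ) (K : ℝ → ℝ → H →L[𝕜] H) : ℝ≥0∞ :=
  ⨆ (t : ℝ) (u : ℝ) (s : ℝ) (_ : Simplex3 T t u s) (θ : ℝ) (_ : θ ∈ Set.Icc (0 : ℝ) 1),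
    ‖K t s - K u s‖ₑ / (‖t - u‖ₑ ^ θ * ‖u - s‖ₑ ^ (-θ - η))

noncomputable def kernelNorm3 (T η : ℝ) (K : ℝ → ℝ → H →L[𝕜] H) : ℝ≥0∞ :=
  ⨆ (t : ℝ) (u : ℝ) (s : ℝ) (_ : Simplex3 T t u s) (θ : ℝ) (_ : θ ∈ Set.Icc (0 : ℝ) 1),
    ‖K t u - K t s‖ₑ / (‖u - s‖ₑ ^ θ * ‖t - u‖ₑ ^ (-θ - η))

/-- The singularity is measured at the smallest distance `|τ - s|` between an upper and a lower
variable (recall `τ' ≥ τ ≥ s ≥ r`). -/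
noncomputable def kernelNorm4 (T η : ℝ) (K : ℝ → ℝ → H →L[𝕜] H) : ℝ≥0∞ :=
  ⨆ (τ' : ℝ) (τ : ℝ) (s : ℝ) (r : ℝ) (_ : Simplex4 T τ' τ s r)
    (θ : ℝ) (_ : θ ∈ Set.Icc (0 : ℝ) 1) (ν : ℝ) (_ : ν ∈ Set.Icc (0 : ℝ) 1),
    ‖K τ' s - K τ' r - K τ s + K τ r‖ₑ /
      (‖τ - s‖ₑ ^ (-ν - θ - η) * ‖τ' - τ‖ₑ ^ ν * ‖s - r‖ₑ ^ θ)

/-- The norm `‖K‖_{𝒦_η}`.  Only the values of `K` on `Δ₂ᵀ` enter. -/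
noncomputable def kernelNorm (T η : ℝ) (K : ℝ → ℝ → H →L[𝕜] H) : ℝ≥0∞ :=
  kernelNorm1 T η K + kernelNorm2 T η K + kernelNorm3 T η K + kernelNorm4 T η K

/-- `K ∈ 𝒦_η`: `K` is a Volterra kernel of order `η` on `[0, T]`. -/
def IsVolterraKernel (T η : ℝ) (K : ℝ → ℝ → H →L[𝕜] H) : Prop :=
  kernelNorm T η K < ∞

noncomputable def covNorm10 (T α : ℝ) (Q : ℝ → ℝ → H →L[𝕜] H) : ℝ≥0∞ :=
  ⨆ (t : ℝ) (s : ℝ) (_ : Simplex2 T t s) (t' : ℝ) (_ : t' ∈ Set.Icc 0 T),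
    ‖Q t t' - Q s t'‖ₑ / ‖t - s‖ₑ ^ α

noncomputable def covNorm01 (T α : ℝ) (Q : ℝ → ℝ → H →L[𝕜] H) : ℝ≥0∞ :=
  ⨆ (t : ℝ) (_ : t ∈ Set.Icc 0 T) (t' : ℝ) (s' : ℝ) (_ : Simplex2 T t' s'),
    ‖Q t t' - Q t s'‖ₑ / ‖t' - s'‖ₑ ^ α

noncomputable def covNorm11 (T α : ℝ) (Q : ℝ → ℝ → H →L[𝕜] H) : ℝ≥0∞ :=
  ⨆ (t : ℝ) (s : ℝ) (_ : Simplex2 T t s) (t' : ℝ) (s' : ℝ) (_ : Simplex2 T t' s'),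
    ‖rectInc Q s s' t t'‖ₑ / (‖t - s‖ₑ * ‖t' - s'‖ₑ) ^ α

/-- The norm `‖Q‖_{𝒬_α}`.  Only the values of `Q` on `[0, T]²` enter. -/
noncomputable def covNorm (T α : ℝ) (Q : ℝ → ℝ → H →L[𝕜] H) : ℝ≥0∞ :=
  covNorm10 T α Q + covNorm01 T α Q + covNorm11 T α Q

/-- `Q ∈ 𝒬_α`: `Q` is an `α`-regular covariance operator on `[0, T]²`. -/
def IsRegularCov (T α : ℝ) (Q : ℝ → ℝ → H →L[𝕜] H) : Prop :=
  covNorm T α Q < ∞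

variable [CompleteSpace H]

/-- The pointwise adjoint kernel `K*(t, s) = K(t, s)*`. -/
noncomputable def adjKernel (K : ℝ → ℝ → H →L[𝕜] H) : ℝ → ℝ → H →L[𝕜] H :=
  fun t s => ContinuousLinearMap.adjoint (K t s)

end Operators

end VolterraSewing

/-!
The double Riemann sum is an iterated one-dimensional one: with `F̂ u` the left composition with
`F u` and `Ĝ u'` the right composition with `G u'`, acting on the Banach space of bounded operators,
it is the Young sum of `F̂` against the function `u ↦ (Young sum of Ĝ against Q u ·)`
(`riemannSum_eq`). Young sums are linear in the integrator, so a bound by the `α`-Hölder constant of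
the integrator, applied to the increments of `Q` in the first variable, shows that the inner sum is
again `α`-Hölder. Hence two one-dimensional bounds multiply (`norm_riemannSum_le`), the double sums
are Cauchy if the one-dimensional ones are, uniformly in the integrator
(`exists_hasDoubleIntegral`), and since all right-hand sides are products of a factor for each
variable, only one-dimensional sums have to be estimated.

For these, fix `θ` with `1 - α < θ < 1 - η` and put `β = θ + α`, `κ = θ + η`, so `β - κ = α - η`.
The defect of additivity at `a ≤ m ≤ b` is of order
`(m - a) ^ θ (b - m) ^ α (τ - m) ^ (-θ - γ)`, or the same with exponent `0` in place of `θ`.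
Using the better of the two, it is bounded, up to a constant, by `ω(a, b) ^ β` for the additive
control `ω(a, b) = ∫_a^b (τ - r) ^ (σ - 1) dr` with `σ = (α - γ) / β` (`SingIncr.mul_rpow_le`). The sewing
lemma for sums (`discrete_sewing`) then bounds the error of the one-term approximation by
`C ω ^ β`, up to the singularity if `γ < α`, and away from it if `γ > α`.

For `K(τ, ·)` one has `γ = η`. For `K(τ₁, ·) - K(τ₂, ·)` with `D = τ₁ - τ₂` one may take `γ = η + ν`
at the price of a factor `D ^ ν`, for each `ν ∈ [0, 1]`. The constant has to be uniform in
`ζ < α - η`, although sewing with `ν = ζ` gives a constant that blows up as `ζ → α - η`. Therefore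
the bounds that persist as `t → τ₂` use only `ν = 0` and `ν = 1`, with the sum split at distance `D`
from the singularity (`SingIncr.sumBound_split`), and the whole family of bounds is
deduced from the resulting three (`SingIncr.sumBound_interp`).
-/

namespace VolterraSewing

/-! ### A discrete sewing lemma -/

/-- The constant of the discrete sewing lemma. -/
noncomputable def sewConst (β : ℝ) : ℝ := 2 / (1 - 2 ^ (1 - β))

lemma two_rpow_one_sub_lt_one {β : ℝ} (hβ : 1 < β) : (2 : ℝ) ^ (1 - β) < 1 :=
  Real.rpow_lt_one_of_one_lt_of_neg (by norm_num) (by linarith)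

lemma sewConst_pos {β : ℝ} (hβ : 1 < β) : 0 < sewConst β :=
  div_pos two_pos (by linarith [two_rpow_one_sub_lt_one hβ])

lemma sewConst_eq {β : ℝ} (hβ : 1 < β) :
    2 * sewConst β * 2⁻¹ ^ β + 2 = sewConst β := by
  have h1 := two_rpow_one_sub_lt_one hβ
  have h2 : (2 : ℝ) * 2⁻¹ ^ β = 2 ^ (1 - β) := by
    rw [Real.rpow_sub two_pos, Real.rpow_one, Real.inv_rpow two_pos.le]; rfl
  have h3 : (1 - (2 : ℝ) ^ (1 - β)) ≠ 0 := by linarith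
  calc 2 * sewConst β * 2⁻¹ ^ β + 2 = sewConst β * (2 * 2⁻¹ ^ β) + 2 := by ring
    _ = sewConst β := by rw [h2, sewConst]; field_simp; ring

/-- Discrete sewing: if the defect of additivity of `Ξ` is at most `D ω ^ β` with `β > 1` and an
additive control `ω i j = w j - w i`, then the sum of `Ξ` over consecutive indices differs from
`Ξ i j` by at most `C(β) D ω ^ β`. -/
lemma discrete_sewing {V : Type*} [NormedAddCommGroup V] {Ξ : ℕ → ℕ → V} {w : ℕ → ℝ}
    {D β : ℝ} {N : ℕ} (hβ : 1 < β) (hD : 0 ≤ D)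
    (hw : ∀ i j, i ≤ j → j ≤ N → w i ≤ w j)
    (hΞ : ∀ i j k, i ≤ j → j ≤ k → k ≤ N → ‖Ξ i k - Ξ i j - Ξ j k‖ ≤ D * (w k - w i) ^ β) :
    ∀ i j, i ≤ j → j ≤ N →
      ‖∑ k ∈ Finset.Ico i j, Ξ k (k + 1) - Ξ i j‖ ≤ sewConst β * D * (w j - w i) ^ β := by
  suffices H : ∀ n i j, i ≤ j → j ≤ N → j - i ≤ n →
      ‖∑ k ∈ Finset.Ico i j, Ξ k (k + 1) - Ξ i j‖ ≤ sewConst β * D * (w j - w i) ^ β from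
    fun i j hij hj => H (j - i) i j hij hj le_rfl
  have hβ0 : β ≠ 0 := by linarith
  have hC := sewConst_pos hβ
  have hdiag : ∀ i, i ≤ N → Ξ i i = 0 := by
    intro i hi
    simpa [Real.zero_rpow hβ0] using hΞ i i i le_rfl le_rfl hi
  intro n
  induction n with
  | zero =>
    intro i j hij hj hn
    obtain rfl : i = j := by omega
    simp [hdiag i hj, Real.zero_rpow hβ0]
  | succ n ih =>
    intro i j hij hj hn
    rcases hij.eq_or_lt with rfl | hlt
    · simp [hdiag i hj, Real.zero_rpow hβ0]
    set W := w j - w i with hW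
    have hW0 : 0 ≤ W := by linarith [hw i j hij hj]
    -- `k` is the last index at which at most half of the control has been used up
    obtain ⟨k, hk, hkmax⟩ := Finset.exists_max_image
      ((Finset.Ico i j).filter fun k => w k - w i ≤ W / 2) id
      ⟨i, by simp [hlt]; linarith⟩
    simp only [Finset.mem_filter, Finset.mem_Ico, id] at hk hkmax
    obtain ⟨⟨hik, hkj⟩, hkW⟩ := hk
    have hright : w j - w (k + 1) ≤ W / 2 := by
      rcases (Nat.succ_le_of_lt hkj).eq_or_lt with h | h
      · rw [← h]; simp; linarith
      · by_contra! hcon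
        have := hkmax (k + 1) ⟨⟨by omega, h⟩, by linarith⟩
        omega
    have e1 := ih i k hik (by omega) (by omega)
    have e2 := ih (k + 1) j hkj hj (by omega)
    have d1 := hΞ i k j hik hkj.le hj
    have d2 := hΞ k (k + 1) j (by omega) hkj hj
    have hmono : ∀ {x : ℝ}, 0 ≤ x → x ≤ W → x ^ β ≤ W ^ β := fun hx hxW =>
      Real.rpow_le_rpow hx hxW (by linarith)
    have hhalf : (W / 2) ^ β = 2⁻¹ ^ β * W ^ β := by
      rw [← Real.mul_rpow (by norm_num) hW0]; congr 1; ring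
    have e1' : ‖∑ l ∈ Finset.Ico i k, Ξ l (l + 1) - Ξ i k‖ ≤
        sewConst β * D * (2⁻¹ ^ β * W ^ β) := by
      refine e1.trans ?_
      rw [← hhalf]
      gcongr
      linarith [hw i k hik (by omega)]
    have e2' : ‖∑ l ∈ Finset.Ico (k + 1) j, Ξ l (l + 1) - Ξ (k + 1) j‖ ≤
        sewConst β * D * (2⁻¹ ^ β * W ^ β) := by
      refine e2.trans ?_
      rw [← hhalf]
      gcongr
      linarith [hw (k + 1) j hkj hj]
    have d2' : ‖Ξ k j - Ξ k (k + 1) - Ξ (k + 1) j‖ ≤ D * W ^ β := by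
      refine d2.trans (mul_le_mul_of_nonneg_left (hmono ?_ ?_) hD)
      · linarith [hw k j hkj.le hj]
      · linarith [hw i k hik (by omega)]
    have hsum : ∑ l ∈ Finset.Ico i j, Ξ l (l + 1) - Ξ i j =
        (∑ l ∈ Finset.Ico i k, Ξ l (l + 1) - Ξ i k) +
        (∑ l ∈ Finset.Ico (k + 1) j, Ξ l (l + 1) - Ξ (k + 1) j) -
        (Ξ i j - Ξ i k - Ξ k j) - (Ξ k j - Ξ k (k + 1) - Ξ (k + 1) j) := by
      rw [← Finset.sum_Ico_consecutive _ hik hkj.le, Finset.sum_eq_sum_Ico_succ_bot hkj]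
      abel
    rw [hsum]
    calc _ ≤ sewConst β * D * (2⁻¹ ^ β * W ^ β) + sewConst β * D * (2⁻¹ ^ β * W ^ β)
          + D * W ^ β + D * W ^ β := by
          refine (norm_sub_le _ _).trans (add_le_add ((norm_sub_le _ _).trans
            (add_le_add ((norm_add_le _ _).trans (add_le_add e1' e2')) d1)) d2')
      _ = (2 * sewConst β * 2⁻¹ ^ β + 2) * D * W ^ β := by ring
      _ = _ := by rw [sewConst_eq hβ]

/-! ### Weights with a power singularity -/

/-- The primitive `-(τ - r) ^ σ / σ` of `r ↦ (τ - r) ^ (σ - 1)`. -/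
noncomputable def singWeight (τ σ r : ℝ) : ℝ := -(τ - r) ^ σ / σ

/-- A primitive of an increasing function lies above its tangents. -/
lemma mul_rpow_le_singWeight_sub {τ σ a b : ℝ} (hσ : σ ≠ 0) (hσ1 : σ ≤ 1)
    (ha : a < τ) (hb : b ≤ τ) (h : 0 < σ ∨ b < τ) :
    (b - a) * (τ - a) ^ (σ - 1) ≤ singWeight τ σ b - singWeight τ σ a := by
  have hx : 0 < τ - a := by linarith
  have hy : 0 ≤ τ - b := by linarith
  set x := τ - a with hxdef
  set y := τ - b with hydef
  have e : singWeight τ σ b - singWeight τ σ a = x ^ σ * ((1 - (y / x) ^ σ) / σ) := by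
    have : y ^ σ = x ^ σ * (y / x) ^ σ := by
      rw [Real.div_rpow hy hx.le]; field_simp
    rw [singWeight, singWeight, ← hxdef, ← hydef, this]; ring
  have e2 : (b - a) * x ^ (σ - 1) = x ^ σ * (1 - y / x) := by
    rw [Real.rpow_sub_one hx.ne']
    have : b - a = x - y := by rw [hxdef, hydef]; ring
    rw [this]; field_simp
  rw [e, e2]
  refine mul_le_mul_of_nonneg_left ?_ (by positivity)
  have hz : 0 ≤ y / x := by positivity
  set z := y / x with hzdef
  rcases hσ.lt_or_gt with hneg | hpos
  · have hz0 : 0 < z := div_pos (by rcases h with h | h <;> [linarith; linarith]) hx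
    rw [le_div_iff_of_neg hneg]
    have h1 := Real.log_le_sub_one_of_pos hz0
    have h2 := Real.add_one_le_exp (Real.log z * σ)
    rw [← Real.rpow_def_of_pos hz0] at h2
    nlinarith
  · rw [le_div_iff₀ hpos]
    have := rpow_one_add_le_one_add_mul_self (s := z - 1) (by linarith) hpos.le hσ1
    rw [add_sub_cancel] at this
    linarith

lemma singWeight_sub_le_rpow {τ σ a b : ℝ} (hσ : 0 < σ) (hσ1 : σ ≤ 1) (hab : a ≤ b) (hb : b ≤ τ) :
    singWeight τ σ b - singWeight τ σ a ≤ (b - a) ^ σ / σ := by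
  have := Real.rpow_add_le_add_rpow (a := τ - b) (b := b - a) (by linarith) (by linarith)
    hσ.le hσ1
  rw [show τ - b + (b - a) = τ - a by ring] at this
  rw [singWeight, singWeight, ← sub_div]
  gcongr
  linarith

lemma singWeight_sub_le_of_neg {τ σ a b : ℝ} (hσ : σ < 0) (ha : a ≤ τ) :
    singWeight τ σ b - singWeight τ σ a ≤ (τ - b) ^ σ / (-σ) := by
  rw [singWeight, singWeight]
  have h1 : 0 ≤ (τ - a) ^ σ := Real.rpow_nonneg (by linarith) _
  have : 0 ≤ (τ - a) ^ σ / (-σ) := div_nonneg h1 (by linarith)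
  have e : -(τ - b) ^ σ / σ - -(τ - a) ^ σ / σ = (τ - b) ^ σ / (-σ) - (τ - a) ^ σ / (-σ) := by
    rw [div_neg, div_neg]; ring
  rw [e]; linarith

/-! ### Functions with singular increments -/

/-- The increments of `F` on `[s, τ)` are bounded by `A (m - a) ^ θ' (τ - m) ^ (-θ' - γ)` for the
two exponents `θ' = 0` and `θ' = θ`. -/
structure SingIncr {V : Type*} [NormedAddCommGroup V] (F : ℝ → V) (s τ γ θ A : ℝ) : Prop where
  nonneg : 0 ≤ A
  le_rpow : ∀ a m, s ≤ a → a ≤ m → m < τ → ‖F m - F a‖ ≤ A * (τ - m) ^ (-γ)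
  le_mul : ∀ a m, s ≤ a → a ≤ m → m < τ → ‖F m - F a‖ ≤ A * (m - a) ^ θ * (τ - m) ^ (-θ - γ)

lemma SingIncr.of_norm_le {V W : Type*} [NormedAddCommGroup V] [NormedAddCommGroup W] {F : ℝ → V}
    {G : ℝ → W} {s τ γ θ A : ℝ} (hF : SingIncr F s τ γ θ A)
    (h : ∀ a m, ‖G m - G a‖ ≤ ‖F m - F a‖) : SingIncr G s τ γ θ A :=
  ⟨hF.nonneg, fun a m h1 h2 h3 => (h a m).trans (hF.le_rpow a m h1 h2 h3),
    fun a m h1 h2 h3 => (h a m).trans (hF.le_mul a m h1 h2 h3)⟩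

lemma singWeight_mono {τ σ a b : ℝ} (hσ : σ ≠ 0) (hσ1 : σ ≤ 1) (hab : a ≤ b)
    (hb : b ≤ τ) (h : 0 < σ ∨ b < τ) : singWeight τ σ a ≤ singWeight τ σ b := by
  rcases hab.eq_or_lt with rfl | hlt
  · exact le_rfl
  have := mul_rpow_le_singWeight_sub (τ := τ) (a := a) (b := b) hσ hσ1 (by linarith) hb h
  have h2 : 0 ≤ (b - a) * (τ - a) ^ (σ - 1) :=
    mul_nonneg (by linarith) (Real.rpow_nonneg (by linarith) _)
  linarith

/-- The defect of the Young sums of a function with singular increments is controlled by the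
weight `(τ - r) ^ (σ - 1)` with `σ = (α - γ) / (θ + α)`. Far from the singularity the exponent `θ`
is used, and when the singularity is closer to `m` than `a` is, the exponent `0`. -/
lemma SingIncr.mul_rpow_le {V : Type*} [NormedAddCommGroup V] {F : ℝ → V}
    {s t τ γ θ A α σ : ℝ} (hF : SingIncr F s τ γ θ A) (hα : 0 ≤ α) (hθ : 0 ≤ θ)
    (hσ : σ * (θ + α) = α - γ) (hσ0 : σ ≠ 0) (hσ1 : σ ≤ 1) (hτ : t ≤ τ) (h : 0 < σ ∨ t < τ)
    {a m b : ℝ} (ha : s ≤ a) (ham : a ≤ m) (hmb : m < b) (hb : b ≤ t) :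
    ‖F m - F a‖ * (b - m) ^ α ≤
      A * 2 ^ (θ + γ) * (singWeight τ σ b - singWeight τ σ a) ^ (θ + α) := by
  have hA := hF.nonneg
  have hx : 0 < τ - m := by linarith
  set x := τ - m with hxdef
  set U := singWeight τ σ b - singWeight τ σ a with hU
  have hsing : ∀ c, c ≤ t → 0 < σ ∨ c < τ := fun c hc =>
    h.imp id fun h => lt_of_le_of_lt hc h
  have hbU : (b - m) * (2 * x) ^ (σ - 1) ≤ U := by
    have h1 := mul_rpow_le_singWeight_sub (τ := τ) (a := m) (b := b) hσ0 hσ1 (by linarith)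
      (by linarith) (hsing b hb)
    have h2 : (2 * x) ^ (σ - 1) ≤ x ^ (σ - 1) :=
      Real.rpow_le_rpow_of_nonpos hx (by linarith) (by linarith)
    have h3 := singWeight_mono (τ := τ) hσ0 hσ1 ham (by linarith) (hsing m (by linarith))
    have h4 := mul_le_mul_of_nonneg_left h2 (show 0 ≤ b - m by linarith)
    linarith
  have hU0 : 0 ≤ U := le_trans (mul_nonneg (by linarith) (by positivity)) hbU
  have h2x : 0 < 2 * x := by linarith
  have hexp : (2 * x) ^ ((σ - 1) * (θ + α)) = (2 : ℝ) ^ (-(θ + γ)) * x ^ (-θ - γ) := by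
    rw [show (σ - 1) * (θ + α) = -(θ + γ) by linarith, Real.mul_rpow two_pos.le hx.le]
    congr 2; ring
  have h22 : (2 : ℝ) ^ (θ + γ) * 2 ^ (-(θ + γ)) = 1 := by
    rw [← Real.rpow_add two_pos, add_neg_cancel, Real.rpow_zero]
  rcases le_total (m - a) x with hcase | hcase
  · have haU : (m - a) * (2 * x) ^ (σ - 1) ≤ U := by
      rcases ham.eq_or_lt with rfl | hlt
      · simpa using hU0
      have h1 := mul_rpow_le_singWeight_sub (τ := τ) (a := a) (b := m) hσ0 hσ1 (by linarith)
        (by linarith) (hsing m (by linarith))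
      have h2 : (2 * x) ^ (σ - 1) ≤ (τ - a) ^ (σ - 1) :=
        Real.rpow_le_rpow_of_nonpos (by linarith) (by linarith) (by linarith)
      have h3 := singWeight_mono (τ := τ) hσ0 hσ1 hmb.le (by linarith) (hsing b (by linarith))
      have h4 := mul_le_mul_of_nonneg_left h2 (show 0 ≤ m - a by linarith)
      linarith
    have hma : 0 ≤ m - a := by linarith
    have hbm : 0 ≤ b - m := by linarith
    have key : (m - a) ^ θ * (b - m) ^ α * (2 ^ (-(θ + γ)) * x ^ (-θ - γ)) ≤ U ^ (θ + α) := by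
      calc (m - a) ^ θ * (b - m) ^ α * (2 ^ (-(θ + γ)) * x ^ (-θ - γ))
          = ((m - a) * (2 * x) ^ (σ - 1)) ^ θ * ((b - m) * (2 * x) ^ (σ - 1)) ^ α := by
            rw [Real.mul_rpow hma (by positivity), Real.mul_rpow hbm (by positivity),
              ← Real.rpow_mul h2x.le, ← Real.rpow_mul h2x.le, ← hexp, mul_add,
              Real.rpow_add h2x]
            ring
        _ ≤ U ^ θ * U ^ α := by
            gcongr
        _ = U ^ (θ + α) := (Real.rpow_add_of_nonneg hU0 hθ hα).symm
    calc ‖F m - F a‖ * (b - m) ^ α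
        ≤ A * (m - a) ^ θ * x ^ (-θ - γ) * (b - m) ^ α := by
          gcongr
          exact hF.le_mul a m ha ham (by linarith)
      _ = A * (2 ^ (θ + γ) * 2 ^ (-(θ + γ))) * ((m - a) ^ θ * (b - m) ^ α * x ^ (-θ - γ)) := by
          rw [h22]; ring
      _ = A * 2 ^ (θ + γ) * ((m - a) ^ θ * (b - m) ^ α * (2 ^ (-(θ + γ)) * x ^ (-θ - γ))) := by
          ring
      _ ≤ _ := by gcongr
  · have hxU : x * (2 * x) ^ (σ - 1) ≤ U := by
      have h1 := mul_rpow_le_singWeight_sub (τ := τ) (a := m - x) (b := m) hσ0 hσ1 (by linarith)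
        (by linarith) (hsing m (by linarith))
      rw [show τ - (m - x) = 2 * x by rw [hxdef]; ring, sub_sub_cancel] at h1
      have h3 := singWeight_mono (τ := τ) (a := a) (b := m - x) hσ0 hσ1 (by linarith)
        (by linarith) (hsing (m - x) (by linarith))
      have h4 := singWeight_mono (τ := τ) hσ0 hσ1 hmb.le (by linarith) (hsing b (by linarith))
      linarith
    have key : x ^ (θ + α) * (2 ^ (-(θ + γ)) * x ^ (-θ - γ)) ≤ U ^ (θ + α) := by
      rw [← hexp, Real.rpow_mul h2x.le, ← Real.mul_rpow hx.le (by positivity)]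
      exact Real.rpow_le_rpow (by positivity) hxU (by linarith)
    calc ‖F m - F a‖ * (b - m) ^ α ≤ A * x ^ (-γ) * x ^ α := by
          gcongr
          · exact hF.le_rpow a m ha ham (by linarith)
          · linarith
      _ = A * (2 ^ (θ + γ) * 2 ^ (-(θ + γ))) * (x ^ (θ + α) * x ^ (-θ - γ)) := by
          rw [h22, mul_one, mul_assoc, ← Real.rpow_add hx, ← Real.rpow_add hx]
          congr 2; ring
      _ = A * 2 ^ (θ + γ) * (x ^ (θ + α) * (2 ^ (-(θ + γ)) * x ^ (-θ - γ))) := by ring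
      _ ≤ _ := by gcongr

/-! ### One-dimensional Young sums -/

/-- `X` is `α`-Hölder continuous on `[s, t]` with constant `M`. -/
def HolderIncr {E : Type*} [NormedAddCommGroup E] (X : ℝ → E) (α M s t : ℝ) : Prop :=
  ∀ a b, s ≤ a → a ≤ b → b ≤ t → ‖X b - X a‖ ≤ M * (b - a) ^ α

lemma HolderIncr.mono {E : Type*} [NormedAddCommGroup E] {X : ℝ → E} {α M s t s' t' : ℝ}
    (hX : HolderIncr X α M s t) (hs : s ≤ s') (ht : t' ≤ t) : HolderIncr X α M s' t' :=
  fun a b ha hab hb => hX a b (hs.trans ha) hab (hb.trans ht)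

section Young

variable {𝕜 E : Type*} [RCLike 𝕜] [NormedAddCommGroup E] [NormedSpace 𝕜 E]

/-- The Riemann–Stieltjes sum `∑_{i ≤ k < j} F(p k) (X (p (k + 1)) - X (p k))`. -/
noncomputable def youngSum (F : ℝ → E →L[𝕜] E) (X : ℝ → E) (p : ℕ → ℝ) (i j : ℕ) : E :=
  ∑ k ∈ Finset.Ico i j, F (p k) (X (p (k + 1)) - X (p k))

/-- The Young estimate for sums, relative to a control `w b - w a`. -/
lemma norm_youngSum_sub_le {F : ℝ → E →L[𝕜] E} {X : ℝ → E} {w : ℝ → ℝ} {s t α β D M : ℝ}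
    (hβ : 1 < β) (hD : 0 ≤ D) (hM : 0 ≤ M)
    (hw : ∀ a b, s ≤ a → a ≤ b → b ≤ t → w a ≤ w b)
    (hF : ∀ a m b, s ≤ a → a ≤ m → m < b → b ≤ t →
      ‖F m - F a‖ * (b - m) ^ α ≤ D * (w b - w a) ^ β)
    (hX : HolderIncr X α M s t) {p : ℕ → ℝ} {N : ℕ} (hp : ∀ i j, i ≤ j → j ≤ N → p i ≤ p j)
    (h0 : s ≤ p 0) (hN : p N ≤ t) {i j : ℕ} (hij : i ≤ j) (hj : j ≤ N) :
    ‖youngSum F X p i j - F (p i) (X (p j) - X (p i))‖ ≤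
      sewConst β * (D * M) * (w (p j) - w (p i)) ^ β := by
  have hs : ∀ k, k ≤ N → s ≤ p k := fun k hk => h0.trans (hp 0 k (Nat.zero_le _) hk)
  have ht : ∀ k, k ≤ N → p k ≤ t := fun k hk => (hp k N hk le_rfl).trans hN
  refine discrete_sewing (Ξ := fun i j => F (p i) (X (p j) - X (p i))) (w := fun i => w (p i))
    hβ (mul_nonneg hD hM)
    (fun i j hij hj => hw _ _ (hs i (hij.trans hj)) (hp i j hij hj) (ht j hj)) ?_ i j hij hj
  intro i j k hij hjk hk
  have e : F (p i) (X (p k) - X (p i)) - F (p i) (X (p j) - X (p i)) -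
      F (p j) (X (p k) - X (p j)) = -((F (p j) - F (p i)) (X (p k) - X (p j))) := by
    simp only [map_sub, sub_apply]; abel
  have hsi := hs i (by omega)
  have hpij := hp i j hij (by omega)
  have htk := ht k hk
  rw [e, norm_neg]
  refine ((F (p j) - F (p i)).le_opNorm _).trans ?_
  have hwik := hw _ _ hsi (hpij.trans (hp j k hjk hk)) htk
  rcases (hp j k hjk hk).eq_or_lt with heq | hlt
  · rw [heq, sub_self, norm_zero, mul_zero]
    exact mul_nonneg (mul_nonneg hD hM) (Real.rpow_nonneg (by linarith) _)
  · calc ‖F (p j) - F (p i)‖ * ‖X (p k) - X (p j)‖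
        ≤ ‖F (p j) - F (p i)‖ * (M * (p k - p j) ^ α) := by
          gcongr
          exact hX _ _ (hs j (by omega)) hlt.le htk
      _ = M * (‖F (p j) - F (p i)‖ * (p k - p j) ^ α) := by ring
      _ ≤ M * (D * (w (p k) - w (p i)) ^ β) := by
          exact mul_le_mul_of_nonneg_left (hF _ _ _ hsi hpij hlt htk) hM
      _ = _ := by ring

end Young

/-! ### Points of a partition -/

lemma Partition.pt_le {a b : ℝ} (P : Partition a b) {i j : ℕ} (hij : i ≤ j) (hj : j ≤ P.n) :
    P.pt i ≤ P.pt j := by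
  induction j, hij using Nat.le_induction with
  | base => exact le_rfl
  | succ j hij ih => exact (ih (by omega)).trans (P.lt_succ j (by omega)).le

lemma Partition.left_le {a b : ℝ} (P : Partition a b) {i : ℕ} (hi : i ≤ P.n) : a ≤ P.pt i :=
  P.pt_zero.ge.trans (P.pt_le (Nat.zero_le i) hi)

lemma Partition.le_right {a b : ℝ} (P : Partition a b) {i : ℕ} (hi : i ≤ P.n) : P.pt i ≤ b :=
  (P.pt_le hi le_rfl).trans P.pt_last.le

lemma Partition.le {a b : ℝ} (P : Partition a b) : a ≤ b :=
  (P.left_le le_rfl).trans P.pt_last.le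

lemma Partition.lt_right {a b : ℝ} (P : Partition a b) {i : ℕ} (hi : i < P.n) : P.pt i < b :=
  (P.lt_succ i hi).trans_le (P.le_right hi)

/-! ### Bounds for Young sums -/

section Young

variable {𝕜 E : Type*} [RCLike 𝕜] [NormedAddCommGroup E] [NormedSpace 𝕜 E]

/-- All Young sums of `F` over partitions of `[s, t]` against an integrator with `α`-Hölder
constant `M` are bounded by `B M`. -/
def SumBound (F : ℝ → E →L[𝕜] E) (α s t B : ℝ) : Prop :=
  ∀ (X : ℝ → E) (M : ℝ), 0 ≤ M → HolderIncr X α M s t → ∀ P : Partition s t,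
    ‖youngSum F X P.pt 0 P.n‖ ≤ B * M

lemma SumBound.mono {F : ℝ → E →L[𝕜] E} {α s t B B' : ℝ} (h : SumBound F α s t B) (hB : B ≤ B') :
    SumBound F α s t B' :=
  fun X M hM hX P => (h X M hM hX P).trans (by gcongr)

lemma sumBound_of_eq_zero {F : ℝ → E →L[𝕜] E} {α s t B : ℝ} (h : ∀ r, s ≤ r → r < t → F r = 0)
    (hB : 0 ≤ B) : SumBound F α s t B := by
  intro X M hM hX P
  have : youngSum F X P.pt 0 P.n = 0 := by
    refine Finset.sum_eq_zero fun k hk => ?_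
    have hk := (Finset.mem_Ico.1 hk).2
    rw [h _ (P.left_le hk.le) (P.lt_right hk)]; rfl
  rw [this, norm_zero]
  positivity

/-- The bound that degenerates as `t` approaches the singularity `τ`. -/
lemma SingIncr.sumBound_regular {F : ℝ → E →L[𝕜] E} {s t τ γ θ A α : ℝ}
    (hF : SingIncr F s τ γ θ A) (hα : 0 ≤ α) (hθ : 0 ≤ θ) (hβ : 1 < θ + α) (hγ : 0 ≤ θ + γ)
    (hτ : t < τ) (hF0 : F s = 0) :
    SumBound F α s t (sewConst (θ + α) * A * (τ - t) ^ (-θ - γ) * (t - s) ^ (θ + α)) := by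
  intro X M hM hX P
  have hA := hF.nonneg
  have hinc : ∀ a m b, s ≤ a → a ≤ m → m < b → b ≤ t →
      ‖F m - F a‖ * (b - m) ^ α ≤ A * (τ - t) ^ (-θ - γ) * (b - a) ^ (θ + α) := by
    intro a m b ha ham hmb hb
    have h1 : (τ - m) ^ (-θ - γ) ≤ (τ - t) ^ (-θ - γ) :=
      Real.rpow_le_rpow_of_nonpos (by linarith) (by linarith) (by linarith)
    have hma : 0 ≤ m - a := by linarith
    have hbm : 0 ≤ b - m := by linarith
    have hba : 0 ≤ b - a := by linarith
    calc ‖F m - F a‖ * (b - m) ^ α ≤ A * (m - a) ^ θ * (τ - m) ^ (-θ - γ) * (b - m) ^ α := by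
          gcongr; exact hF.le_mul a m ha ham (by linarith)
      _ ≤ A * (b - a) ^ θ * (τ - t) ^ (-θ - γ) * (b - a) ^ α := by
          have : 0 < τ - m := by linarith
          gcongr
      _ = _ := by rw [Real.rpow_add_of_nonneg hba hθ hα]; ring
  have hD : 0 ≤ A * (τ - t) ^ (-θ - γ) := mul_nonneg hA (Real.rpow_nonneg (by linarith) _)
  have h := norm_youngSum_sub_le (w := id) hβ hD hM (fun _ _ _ h _ => h) hinc hX
    (fun i j hij hj => P.pt_le hij hj) P.pt_zero.ge P.pt_last.le (Nat.zero_le _) le_rfl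
  rw [P.pt_zero, P.pt_last, hF0] at h
  simp only [zero_apply, sub_zero, id] at h
  refine h.trans_eq (by ring)

/-- The constant of the sewing estimates near the singularity. -/
noncomputable def singConst (θ α γ : ℝ) : ℝ :=
  sewConst (θ + α) * 2 ^ (θ + γ) * (|α - γ| / (θ + α)) ^ (-(θ + α))

lemma singConst_nonneg {θ α γ : ℝ} (hβ : 1 < θ + α) : 0 ≤ singConst θ α γ := by
  have := sewConst_pos hβ
  unfold singConst
  have : 0 ≤ |α - γ| / (θ + α) := div_nonneg (abs_nonneg _) (by linarith)
  positivity

/-- The sewing estimate with the singular weight, for `γ < α` up to the singularity and for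
`γ > α` away from it. -/
lemma SingIncr.norm_youngSum_sub_le {F : ℝ → E →L[𝕜] E} {X : ℝ → E} {s t τ γ θ A α M : ℝ}
    (hF : SingIncr F s τ γ θ A) (hα : 0 ≤ α) (hθ : 0 ≤ θ) (hβ : 1 < θ + α) (hγ : 0 ≤ θ + γ)
    (hτ : t ≤ τ) (hsing : γ < α ∨ α < γ ∧ t < τ) (hM : 0 ≤ M) (hX : HolderIncr X α M s t)
    {p : ℕ → ℝ} {N : ℕ} (hp : ∀ i j, i ≤ j → j ≤ N → p i ≤ p j)
    (h0 : s ≤ p 0) (hN : p N ≤ t) {i j : ℕ} (hij : i ≤ j) (hj : j ≤ N) :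
    ‖youngSum F X p i j - F (p i) (X (p j) - X (p i))‖ ≤
      sewConst (θ + α) * (A * 2 ^ (θ + γ) * M) *
        (singWeight τ ((α - γ) / (θ + α)) (p j) - singWeight τ ((α - γ) / (θ + α)) (p i)) ^
          (θ + α) := by
  have hβ0 : 0 < θ + α := by linarith
  have hσ0 : (α - γ) / (θ + α) ≠ 0 :=
    div_ne_zero (by rcases hsing with h | h <;> [linarith; linarith [h.1]]) hβ0.ne'
  have hσ1 : (α - γ) / (θ + α) ≤ 1 := by rw [div_le_one hβ0]; linarith
  have hsing' : 0 < (α - γ) / (θ + α) ∨ t < τ :=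
    hsing.imp (fun h => div_pos (by linarith) hβ0) (fun h => h.2)
  refine VolterraSewing.norm_youngSum_sub_le hβ (mul_nonneg hF.nonneg (by positivity)) hM ?_ ?_ hX
    hp h0 hN hij hj
  · intro a b _ hab hb
    exact singWeight_mono hσ0 hσ1 hab (hb.trans hτ) (hsing'.imp id fun h => hb.trans_lt h)
  · intro a m b ha ham hmb hb
    exact hF.mul_rpow_le hα hθ (div_mul_cancel₀ _ hβ0.ne') hσ0 hσ1 hτ hsing' ha ham hmb hb

/-- Integrable singularity: the error of the one-term approximation is bounded up to `τ`. -/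
lemma SingIncr.norm_youngSum_sub_le_of_lt {F : ℝ → E →L[𝕜] E} {X : ℝ → E} {s t τ γ θ A α M : ℝ}
    (hF : SingIncr F s τ γ θ A) (hα : 0 ≤ α) (hθ : 0 ≤ θ) (hβ : 1 < θ + α) (hγ : 0 ≤ θ + γ)
    (hτ : t ≤ τ) (hγα : γ < α) (hM : 0 ≤ M) (hX : HolderIncr X α M s t)
    {p : ℕ → ℝ} {N : ℕ} (hp : ∀ i j, i ≤ j → j ≤ N → p i ≤ p j)
    (h0 : s ≤ p 0) (hN : p N ≤ t) {i j : ℕ} (hij : i ≤ j) (hj : j ≤ N) :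
    ‖youngSum F X p i j - F (p i) (X (p j) - X (p i))‖ ≤
      singConst θ α γ * A * (p j - p i) ^ (α - γ) * M := by
  have hβ0 : 0 < θ + α := by linarith
  have hA := hF.nonneg
  have hS := sewConst_pos hβ
  refine (hF.norm_youngSum_sub_le hα hθ hβ hγ hτ (Or.inl hγα) hM hX hp h0 hN hij hj).trans ?_
  set σ := (α - γ) / (θ + α) with hσ
  have hσ0 : 0 < σ := div_pos (by linarith) hβ0
  have hσ1 : σ ≤ 1 := by rw [hσ, div_le_one hβ0]; linarith
  have hpij := hp i j hij hj
  have hpj : p j ≤ τ := (hp j N hj le_rfl).trans (hN.trans hτ)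
  have h1 := singWeight_sub_le_rpow hσ0 hσ1 hpij hpj
  have h2 := singWeight_mono hσ0.ne' hσ1 hpij hpj (Or.inl hσ0)
  have hd : 0 ≤ p j - p i := by linarith
  have h3 : ((p j - p i) ^ σ / σ) ^ (θ + α) =
      (p j - p i) ^ (α - γ) * (|α - γ| / (θ + α)) ^ (-(θ + α)) := by
    rw [abs_of_pos (by linarith), ← hσ, Real.div_rpow (by positivity) hσ0.le,
      ← Real.rpow_mul hd, hσ, div_mul_cancel₀ _ hβ0.ne', Real.rpow_neg (hσ ▸ hσ0.le)]
    rfl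
  calc _ ≤ sewConst (θ + α) * (A * 2 ^ (θ + γ) * M) * ((p j - p i) ^ σ / σ) ^ (θ + α) := by
        have : 0 ≤ singWeight τ σ (p j) - singWeight τ σ (p i) := by linarith
        gcongr
    _ = _ := by rw [h3, singConst]; ring

/-- Non-integrable singularity: the error of the one-term approximation away from `τ`. -/
lemma SingIncr.norm_youngSum_sub_le_of_gt {F : ℝ → E →L[𝕜] E} {X : ℝ → E} {s t τ γ θ A α M : ℝ}
    (hF : SingIncr F s τ γ θ A) (hα : 0 ≤ α) (hθ : 0 ≤ θ) (hβ : 1 < θ + α) (hγ : 0 ≤ θ + γ)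
    (hτ : t < τ) (hγα : α < γ) (hM : 0 ≤ M) (hX : HolderIncr X α M s t)
    {p : ℕ → ℝ} {N : ℕ} (hp : ∀ i j, i ≤ j → j ≤ N → p i ≤ p j)
    (h0 : s ≤ p 0) (hN : p N ≤ t) {i j : ℕ} (hij : i ≤ j) (hj : j ≤ N) :
    ‖youngSum F X p i j - F (p i) (X (p j) - X (p i))‖ ≤
      singConst θ α γ * A * (τ - p j) ^ (α - γ) * M := by
  have hβ0 : 0 < θ + α := by linarith
  have hA := hF.nonneg
  have hS := sewConst_pos hβ
  refine (hF.norm_youngSum_sub_le hα hθ hβ hγ hτ.le (Or.inr ⟨hγα, hτ⟩) hM hX hp h0 hN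
    hij hj).trans ?_
  set σ := (α - γ) / (θ + α) with hσ
  have hσ0 : σ < 0 := div_neg_of_neg_of_pos (by linarith) hβ0
  have hpij := hp i j hij hj
  have hpj : p j < τ := (hp j N hj le_rfl).trans_lt (hN.trans_lt hτ)
  have h1 := singWeight_sub_le_of_neg (τ := τ) (a := p i) (b := p j) hσ0 (by linarith)
  have h2 := singWeight_mono hσ0.ne (by linarith) hpij hpj.le (Or.inr hpj)
  have hd : 0 ≤ τ - p j := by linarith
  have h3 : ((τ - p j) ^ σ / (-σ)) ^ (θ + α) =
      (τ - p j) ^ (α - γ) * (|α - γ| / (θ + α)) ^ (-(θ + α)) := by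
    have e : |α - γ| / (θ + α) = -σ := by
      rw [abs_of_neg (by linarith), hσ, neg_div]
    rw [e, Real.div_rpow (by positivity) (by linarith),
      ← Real.rpow_mul hd, Real.rpow_neg (by linarith), hσ, div_mul_cancel₀ _ hβ0.ne']
    rfl
  calc _ ≤ sewConst (θ + α) * (A * 2 ^ (θ + γ) * M) * ((τ - p j) ^ σ / (-σ)) ^ (θ + α) := by
        have : 0 ≤ singWeight τ σ (p j) - singWeight τ σ (p i) := by linarith
        gcongr
    _ = _ := by rw [h3, singConst]; ring

lemma SingIncr.sumBound_of_lt {F : ℝ → E →L[𝕜] E} {s t τ γ θ A α : ℝ}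
    (hF : SingIncr F s τ γ θ A) (hα : 0 ≤ α) (hθ : 0 ≤ θ) (hβ : 1 < θ + α) (hγ : 0 ≤ θ + γ)
    (hτ : t ≤ τ) (hγα : γ < α) (hF0 : F s = 0) :
    SumBound F α s t (singConst θ α γ * A * (t - s) ^ (α - γ)) := by
  intro X M hM hX P
  have h := hF.norm_youngSum_sub_le_of_lt hα hθ hβ hγ hτ hγα hM hX
    (fun i j hij hj => P.pt_le hij hj) P.pt_zero.ge P.pt_last.le (Nat.zero_le P.n) le_rfl
  rwa [P.pt_zero, P.pt_last, hF0, zero_apply, sub_zero] at h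

lemma SingIncr.sumBound_of_gt {F : ℝ → E →L[𝕜] E} {s t τ γ θ A α : ℝ}
    (hF : SingIncr F s τ γ θ A) (hα : 0 ≤ α) (hθ : 0 ≤ θ) (hβ : 1 < θ + α) (hγ : 0 ≤ θ + γ)
    (hτ : t < τ) (hγα : α < γ) (hF0 : F s = 0) :
    SumBound F α s t (singConst θ α γ * A * (τ - t) ^ (α - γ)) := by
  intro X M hM hX P
  have h := hF.norm_youngSum_sub_le_of_gt hα hθ hβ hγ hτ hγα hM hX
    (fun i j hij hj => P.pt_le hij hj) P.pt_zero.ge P.pt_last.le (Nat.zero_le P.n) le_rfl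
  rwa [P.pt_zero, P.pt_last, hF0, zero_apply, sub_zero] at h

/-- If the increments of `F` are bounded both with singularity exponent `η < α` and constant `A`
and with exponent `η + 1` and constant `A D`, the two regimes meet at distance `D` from the
singularity. Splitting there gives a bound by `D ^ (α - η)`. -/
lemma SingIncr.sumBound_split {F : ℝ → E →L[𝕜] E} {s t τ η θ A D α : ℝ}
    (hF0 : SingIncr F s τ η θ A) (hF1 : SingIncr F s τ (η + 1) θ (A * D)) (hα : 0 ≤ α)
    (hα1 : α < 1) (hη : 0 ≤ η) (hθ : 0 ≤ θ) (hβ : 1 < θ + α) (hηα : η < α) (hτ : t ≤ τ)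
    (hD : 0 < D) (hD1 : τ - t < D) (hD2 : D ≤ τ - s) (hFs : F s = 0) :
    SumBound F α s t ((singConst θ α η + singConst θ α (η + 1) + 2) * A * D ^ (α - η)) := by
  intro X M hM hX P
  have hA := hF0.nonneg
  have hp : ∀ i j, i ≤ j → j ≤ P.n → P.pt i ≤ P.pt j := fun i j hij hj => P.pt_le hij hj
  -- `k` is the last index at distance at least `D` from the singularity
  obtain ⟨k, hk, hkmax⟩ := Finset.exists_max_image
    ((Finset.range (P.n + 1)).filter fun k => P.pt k ≤ τ - D) id
    ⟨0, by simp [P.pt_zero]; linarith⟩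
  simp only [Finset.mem_filter, Finset.mem_range, id] at hk hkmax
  obtain ⟨hkn, hkq⟩ := hk
  have hkn' : k < P.n := by
    rcases (Nat.lt_succ_iff.1 hkn).eq_or_lt with h | h
    · rw [h, P.pt_last] at hkq; linarith
    · exact h
  have hk1 : τ - D < P.pt (k + 1) := by
    by_contra! hcon
    have := hkmax (k + 1) ⟨by omega, hcon⟩
    omega
  have hks := P.left_le hkn'.le
  have hk1t := P.le_right (i := k + 1) hkn'
  have hkt := P.lt_right hkn'
  have hkk := P.lt_succ k hkn'
  have hDρ : 0 ≤ D ^ (α - η) := by positivity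
  -- the sum before the splitting interval
  have b1 : ‖youngSum F X P.pt 0 k‖ ≤ singConst θ α (η + 1) * A * D ^ (α - η) * M := by
    have h := hF1.norm_youngSum_sub_le_of_gt (t := P.pt k) (X := X) (p := P.pt) (N := k) hα hθ hβ
      (by linarith) (by linarith) (by linarith) hM (hX.mono le_rfl hkt.le)
      (fun i j hij hj => hp i j hij (by omega)) P.pt_zero.ge le_rfl (Nat.zero_le k) le_rfl
    rw [P.pt_zero, hFs, zero_apply, sub_zero] at h
    refine h.trans ?_
    have h1 : (τ - P.pt k) ^ (α - (η + 1)) ≤ D ^ (α - (η + 1)) :=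
      Real.rpow_le_rpow_of_nonpos hD (by linarith) (by linarith)
    have h2 : D * D ^ (α - (η + 1)) = D ^ (α - η) := by
      rw [show α - (η + 1) = (α - η) - 1 by ring, Real.rpow_sub_one hD.ne']; field_simp
    have hc := singConst_nonneg (γ := η + 1) hβ
    calc _ ≤ singConst θ α (η + 1) * (A * D) * D ^ (α - (η + 1)) * M := by gcongr
      _ = singConst θ α (η + 1) * A * (D * D ^ (α - (η + 1))) * M := by ring
      _ = _ := by rw [h2]
  -- the splitting interval
  have b2 : ‖F (P.pt k) (X (P.pt (k + 1)) - X (P.pt k))‖ ≤ A * D ^ (α - η) * M := by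
    have hx : 0 < τ - P.pt k := by linarith
    have h1 : ‖F (P.pt k)‖ ≤ A * D * (τ - P.pt k) ^ (-(η + 1)) := by
      simpa [hFs] using hF1.le_rpow s (P.pt k) le_rfl hks (by linarith)
    have h2 := hX _ _ hks hkk.le hk1t
    have h3 : (P.pt (k + 1) - P.pt k) ^ α ≤ (τ - P.pt k) ^ α :=
      Real.rpow_le_rpow (by linarith) (by linarith) hα
    have h4 : (τ - P.pt k) ^ (α - (η + 1)) ≤ D ^ (α - (η + 1)) :=
      Real.rpow_le_rpow_of_nonpos hD (by linarith) (by linarith)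
    have h5 : D * D ^ (α - (η + 1)) = D ^ (α - η) := by
      rw [show α - (η + 1) = (α - η) - 1 by ring, Real.rpow_sub_one hD.ne']; field_simp
    calc _ ≤ ‖F (P.pt k)‖ * ‖X (P.pt (k + 1)) - X (P.pt k)‖ := (F _).le_opNorm _
      _ ≤ (A * D * (τ - P.pt k) ^ (-(η + 1))) * (M * (τ - P.pt k) ^ α) := by
          refine mul_le_mul h1 (h2.trans (by gcongr)) (norm_nonneg _) (by positivity)
      _ = A * D * (τ - P.pt k) ^ (α - (η + 1)) * M := by
          rw [show α - (η + 1) = -(η + 1) + α by ring, Real.rpow_add hx]; ring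
      _ ≤ A * D * D ^ (α - (η + 1)) * M := by gcongr
      _ = A * (D * D ^ (α - (η + 1))) * M := by ring
      _ = _ := by rw [h5]
  -- the sum after the splitting interval
  have b3 : ‖youngSum F X P.pt (k + 1) P.n‖ ≤ (singConst θ α η + 1) * A * D ^ (α - η) * M := by
    have hc := singConst_nonneg (γ := η) hβ
    have h := hF0.norm_youngSum_sub_le_of_lt hα hθ hβ (by linarith) hτ hηα hM hX hp
      P.pt_zero.ge P.pt_last.le hkn' le_rfl
    rw [P.pt_last] at h
    have h1 : (t - P.pt (k + 1)) ^ (α - η) ≤ D ^ (α - η) :=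
      Real.rpow_le_rpow (by linarith) (by linarith) (by linarith)
    have h2 : ‖F (P.pt (k + 1)) (X t - X (P.pt (k + 1)))‖ ≤ A * D ^ (α - η) * M := by
      rcases hk1t.eq_or_lt with heq | hlt
      · rw [heq, sub_self, map_zero, norm_zero]; positivity
      have hx : 0 < τ - P.pt (k + 1) := by linarith
      have h3 : ‖F (P.pt (k + 1))‖ ≤ A * (τ - P.pt (k + 1)) ^ (-η) := by
        simpa [hFs] using hF0.le_rpow s (P.pt (k + 1)) le_rfl (by linarith) (by linarith)
      have h4 := hX (P.pt (k + 1)) t (by linarith) hlt.le le_rfl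
      have h5 : (t - P.pt (k + 1)) ^ α ≤ (τ - P.pt (k + 1)) ^ α :=
        Real.rpow_le_rpow (by linarith) (by linarith) hα
      calc _ ≤ ‖F (P.pt (k + 1))‖ * ‖X t - X (P.pt (k + 1))‖ := (F _).le_opNorm _
        _ ≤ (A * (τ - P.pt (k + 1)) ^ (-η)) * (M * (τ - P.pt (k + 1)) ^ α) := by
            refine mul_le_mul h3 (h4.trans (by gcongr)) (norm_nonneg _) (by positivity)
        _ = A * (τ - P.pt (k + 1)) ^ (α - η) * M := by
            rw [show α - η = -η + α by ring, Real.rpow_add hx]; ring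
        _ ≤ _ := by
            gcongr
            linarith
    calc ‖youngSum F X P.pt (k + 1) P.n‖
        ≤ ‖youngSum F X P.pt (k + 1) P.n - F (P.pt (k + 1)) (X t - X (P.pt (k + 1)))‖ +
          ‖F (P.pt (k + 1)) (X t - X (P.pt (k + 1)))‖ := by
            simpa using norm_add_le (youngSum F X P.pt (k + 1) P.n -
              F (P.pt (k + 1)) (X t - X (P.pt (k + 1)))) (F (P.pt (k + 1)) (X t - X (P.pt (k + 1))))
      _ ≤ singConst θ α η * A * D ^ (α - η) * M + A * D ^ (α - η) * M :=
          add_le_add (h.trans (by gcongr)) h2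
      _ = _ := by ring
  have hsum : youngSum F X P.pt 0 P.n = youngSum F X P.pt 0 k +
      (F (P.pt k) (X (P.pt (k + 1)) - X (P.pt k)) + youngSum F X P.pt (k + 1) P.n) := by
    simp only [youngSum]
    rw [← Finset.sum_Ico_consecutive _ (Nat.zero_le k) hkn'.le,
      Finset.sum_eq_sum_Ico_succ_bot hkn']
  rw [hsum]
  refine ((norm_add_le _ _).trans (add_le_add b1 ((norm_add_le _ _).trans
    (add_le_add b2 b3)))).trans_eq (by ring)

/-- All the bounds by `D ^ ϑ (τ - t) ^ (-ϑ + ζ) (τ - s) ^ (α - η - ζ)` follow, with one constant,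
from the three bounds without parameters that hold for `D ≥ τ - s`, for `τ - t < D ≤ τ - s` and for
`D ≤ τ - t`. -/
lemma SingIncr.sumBound_interp {F : ℝ → E →L[𝕜] E} {s t τ η θ A D α ζ ϑ : ℝ}
    (hF0 : SingIncr F s τ η θ A) (hF1 : SingIncr F s τ (η + 1) θ (A * D)) (hα : 0 ≤ α)
    (hα1 : α < 1) (hη : 0 ≤ η) (hθ : 0 ≤ θ) (hβ : 1 < θ + α) (hηα : η < α) (hst : s ≤ t)
    (hτ : t ≤ τ) (hD : 0 ≤ D) (hFs : F s = 0) (hζ0 : 0 ≤ ζ) (hζ : ζ ≤ α - η) (hζϑ : ζ ≤ ϑ)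
    (hϑ : ϑ ≤ 1) (hsing : t < τ ∨ ϑ = ζ) :
    SumBound F α s t ((singConst θ α η + singConst θ α (η + 1) + 2) * A *
      (D ^ ϑ * (τ - t) ^ (-ϑ + ζ) * (τ - s) ^ (α - η - ζ))) := by
  have hA := hF0.nonneg
  have hc0 := singConst_nonneg (γ := η) hβ
  have hc1 := singConst_nonneg (γ := η + 1) hβ
  have hy : 0 ≤ τ - t := by linarith
  have hrhs : 0 ≤ (singConst θ α η + singConst θ α (η + 1) + 2) * A *
      (D ^ ϑ * (τ - t) ^ (-ϑ + ζ) * (τ - s) ^ (α - η - ζ)) := by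
    have : 0 ≤ τ - s := by linarith
    positivity
  rcases hst.eq_or_lt with rfl | hlt
  · exact sumBound_of_eq_zero (fun r h1 h2 => absurd h1 (not_le.2 h2)) hrhs
  have hL : 0 < τ - s := by linarith
  rcases hD.eq_or_lt with rfl | hDpos
  · refine sumBound_of_eq_zero (fun r h1 h2 => ?_) hrhs
    have := hF1.le_rpow s r le_rfl h1 (by linarith)
    simpa [hFs] using this
  rcases le_or_gt D (τ - t) with hDy | hDy
  · have hypos : 0 < τ - t := hDpos.trans_le hDy
    refine (hF1.sumBound_of_gt hα hθ hβ (by linarith) (by linarith) (by linarith) hFs).mono ?_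
    have key : D * (τ - t) ^ (α - (η + 1)) ≤
        D ^ ϑ * (τ - t) ^ (-ϑ + ζ) * (τ - s) ^ (α - η - ζ) := by
      calc D * (τ - t) ^ (α - (η + 1)) = D ^ ϑ * D ^ (1 - ϑ) * (τ - t) ^ (α - (η + 1)) := by
            rw [← Real.rpow_add hDpos, add_sub_cancel, Real.rpow_one]
        _ ≤ D ^ ϑ * (τ - t) ^ (1 - ϑ) * (τ - t) ^ (α - (η + 1)) := by
            gcongr
        _ = D ^ ϑ * (τ - t) ^ (-ϑ + ζ) * (τ - t) ^ (α - η - ζ) := by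
            rw [mul_assoc, mul_assoc, ← Real.rpow_add hypos, ← Real.rpow_add hypos]
            congr 2; ring
        _ ≤ _ := by
            gcongr
    calc singConst θ α (η + 1) * (A * D) * (τ - t) ^ (α - (η + 1))
        = singConst θ α (η + 1) * A * (D * (τ - t) ^ (α - (η + 1))) := by ring
      _ ≤ _ := by
        gcongr
        linarith
  · have hDζ : D ^ ζ ≤ D ^ ϑ * (τ - t) ^ (-ϑ + ζ) := by
      rcases hsing with h | rfl
      · have hypos : 0 < τ - t := by linarith
        calc D ^ ζ = D ^ ϑ * D ^ (-ϑ + ζ) := by rw [← Real.rpow_add hDpos]; congr 1; ring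
          _ ≤ _ := by
            gcongr D ^ ϑ * ?_
            exact Real.rpow_le_rpow_of_nonpos hypos hDy.le (by linarith)
      · simp
    rcases le_total (τ - s) D with hDL | hDL
    · refine (hF0.sumBound_of_lt hα hθ hβ (by linarith) hτ hηα hFs).mono ?_
      have key : (t - s) ^ (α - η) ≤ D ^ ϑ * (τ - t) ^ (-ϑ + ζ) * (τ - s) ^ (α - η - ζ) := by
        calc (t - s) ^ (α - η) ≤ (τ - s) ^ (α - η) :=
              Real.rpow_le_rpow (by linarith) (by linarith) (by linarith)
          _ = (τ - s) ^ ζ * (τ - s) ^ (α - η - ζ) := by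
              rw [← Real.rpow_add hL, add_sub_cancel]
          _ ≤ D ^ ζ * (τ - s) ^ (α - η - ζ) := by gcongr
          _ ≤ _ := by gcongr
      gcongr
      linarith
    · refine (hF0.sumBound_split hF1 hα hα1 hη hθ hβ hηα hτ hDpos hDy hDL hFs).mono ?_
      have key : D ^ (α - η) ≤ D ^ ϑ * (τ - t) ^ (-ϑ + ζ) * (τ - s) ^ (α - η - ζ) := by
        calc D ^ (α - η) = D ^ ζ * D ^ (α - η - ζ) := by
              rw [← Real.rpow_add hDpos, add_sub_cancel]
          _ ≤ D ^ ζ * (τ - s) ^ (α - η - ζ) := by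
              gcongr
          _ ≤ _ := by gcongr
      gcongr

end Young

/-! ### Refinements, concatenations and small meshes of partitions -/

lemma Partition.pt_lt {a b : ℝ} (P : Partition a b) {i j : ℕ} (hij : i < j) (hj : j ≤ P.n) :
    P.pt i < P.pt j :=
  (P.lt_succ i (by omega)).trans_le (P.pt_le hij hj)

lemma Partition.index_le {a b : ℝ} (P : Partition a b) {i j : ℕ} (hi : i ≤ P.n)
    (h : P.pt i ≤ P.pt j) : i ≤ j := by
  by_contra! hlt
  exact absurd h (not_le.2 (P.pt_lt hlt hi))

/-- A finite set containing both end points is the set of points of a partition. -/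
lemma exists_partition_of_finset {a b : ℝ} (S : Finset ℝ) (ha : a ∈ S) (hb : b ∈ S)
    (hS : ∀ x ∈ S, a ≤ x ∧ x ≤ b) :
    ∃ R : Partition a b, ∀ x ∈ S, ∃ k, k ≤ R.n ∧ R.pt k = x := by
  obtain ⟨N, hN⟩ : ∃ N, S.card = N + 1 :=
    Nat.exists_eq_succ_of_ne_zero (Finset.card_ne_zero_of_mem ha)
  set e := S.orderEmbOfFin hN with he
  have hmem : ∀ k, e k ∈ S := Finset.orderEmbOfFin_mem S hN
  have hsurj : ∀ x ∈ S, ∃ k, e k = x := by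
    intro x hx
    have := Finset.range_orderEmbOfFin S hN
    exact this.ge hx
  let pt : ℕ → ℝ := fun k => if h : k < N + 1 then e ⟨k, h⟩ else b
  have hpt : ∀ k (h : k < N + 1), pt k = e ⟨k, h⟩ := fun k h => dif_pos h
  refine ⟨⟨N, pt, ?_, ?_, ?_⟩, ?_⟩
  · obtain ⟨k, hk⟩ := hsurj a ha
    rw [hpt 0 (by omega)]
    refine le_antisymm ?_ (hS _ (hmem _)).1
    rw [← hk]
    exact e.monotone (Fin.mk_le_mk.2 (Nat.zero_le _))
  · obtain ⟨k, hk⟩ := hsurj b hb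
    rw [hpt N (by omega)]
    refine le_antisymm (hS _ (hmem _)).2 ?_
    rw [← hk]
    exact e.monotone (Fin.mk_le_mk.2 (by omega))
  · intro i hi
    rw [hpt i (by omega), hpt (i + 1) (by omega)]
    exact e.strictMono (Fin.mk_lt_mk.2 (by omega))
  · intro x hx
    obtain ⟨k, hk⟩ := hsurj x hx
    exact ⟨k, by simpa using Nat.lt_succ_iff.1 k.2, by simp only; rw [hpt k k.2]; exact hk⟩

/-- `R` refines `P`: every point of `P` is a point of `R`. -/
def Partition.Refines {a b : ℝ} (R P : Partition a b) : Prop :=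
  ∀ i, i ≤ P.n → ∃ k, k ≤ R.n ∧ R.pt k = P.pt i

lemma exists_common_refinement {a b : ℝ} (P P' : Partition a b) :
    ∃ R : Partition a b, R.Refines P ∧ R.Refines P' := by
  classical
  obtain ⟨R, hR⟩ := exists_partition_of_finset (a := a) (b := b)
    ((Finset.range (P.n + 1)).image P.pt ∪ (Finset.range (P'.n + 1)).image P'.pt)
    (Finset.mem_union_left _ (Finset.mem_image.2 ⟨0, by simp, P.pt_zero⟩))
    (Finset.mem_union_left _ (Finset.mem_image.2 ⟨P.n, by simp, P.pt_last⟩))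
    (by
      intro x hx
      rcases Finset.mem_union.1 hx with h | h <;> obtain ⟨i, hi, rfl⟩ := Finset.mem_image.1 h
      · have := Nat.lt_succ_iff.1 (Finset.mem_range.1 hi)
        exact ⟨P.left_le this, P.le_right this⟩
      · have := Nat.lt_succ_iff.1 (Finset.mem_range.1 hi)
        exact ⟨P'.left_le this, P'.le_right this⟩)
  exact ⟨R,
    fun i hi => hR _ (Finset.mem_union_left _ (Finset.mem_image.2 ⟨i, by simp; omega, rfl⟩)),
    fun i hi => hR _ (Finset.mem_union_right _ (Finset.mem_image.2 ⟨i, by simp; omega, rfl⟩))⟩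

lemma Partition.Refines.exists_index {a b : ℝ} {R P : Partition a b} (h : R.Refines P) :
    ∃ φ : ℕ → ℕ, φ 0 = 0 ∧ φ P.n = R.n ∧ (∀ i, i < P.n → φ i ≤ φ (i + 1)) ∧
      ∀ i, i ≤ P.n → φ i ≤ R.n ∧ R.pt (φ i) = P.pt i := by
  choose! φ hφ using h
  refine ⟨φ, ?_, ?_, ?_, hφ⟩
  · refine Nat.le_zero.1 (R.index_le (hφ 0 (Nat.zero_le _)).1 ?_)
    rw [(hφ 0 (Nat.zero_le _)).2, P.pt_zero, R.pt_zero]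
  · refine le_antisymm (hφ _ le_rfl).1 (R.index_le le_rfl ?_)
    rw [(hφ _ le_rfl).2, P.pt_last, R.pt_last]
  · intro i hi
    refine R.index_le (hφ i hi.le).1 ?_
    rw [(hφ i hi.le).2, (hφ (i + 1) hi).2]
    exact (P.lt_succ i hi).le

lemma exists_partition_meshLT {a b δ : ℝ} (hab : a ≤ b) (hδ : 0 < δ) :
    ∃ P : Partition a b, P.MeshLT δ := by
  rcases hab.eq_or_lt with rfl | hlt
  · exact ⟨⟨0, fun _ => a, rfl, rfl, fun i hi => absurd hi (Nat.not_lt_zero _)⟩,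
      fun i hi => absurd hi (Nat.not_lt_zero _)⟩
  obtain ⟨n, hn⟩ := exists_nat_gt ((b - a) / δ)
  have hn0 : (0 : ℝ) < n := (div_pos (by linarith) hδ).trans hn
  have hstep : ∀ i : ℕ, a + ((i + 1 : ℕ) : ℝ) * ((b - a) / n) - (a + i * ((b - a) / n)) =
      (b - a) / n := by
    intro i; push_cast; ring
  refine ⟨⟨n, fun i => a + i * ((b - a) / n), by simp, by field_simp; ring, ?_⟩, ?_⟩
  · intro i _
    have : 0 < (b - a) / n := div_pos (by linarith) hn0
    linarith [hstep i]
  · intro i _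
    simp only [hstep]
    rw [div_lt_iff₀ hn0]
    rw [div_lt_iff₀ hδ] at hn
    linarith

/-- The concatenation of a partition of `[a, b]` and a partition of `[b, c]`. -/
def Partition.append {a b c : ℝ} (P : Partition a b) (R : Partition b c) : Partition a c where
  n := P.n + R.n
  pt := fun i => if i < P.n then P.pt i else R.pt (i - P.n)
  pt_zero := by
    split_ifs with h
    · exact P.pt_zero
    · have h0 : P.n = 0 := by omega
      rw [Nat.zero_sub, R.pt_zero, ← P.pt_last, h0, P.pt_zero]
  pt_last := by
    rw [if_neg (by omega), Nat.add_sub_cancel_left, R.pt_last]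
  lt_succ := by
    intro i hi
    by_cases h : i < P.n
    · have := P.lt_succ i h
      by_cases h' : i + 1 < P.n
      · rwa [if_pos h, if_pos h']
      · have e : i + 1 = P.n := by omega
        rw [if_pos h, if_neg h', e, Nat.sub_self, R.pt_zero]
        exact P.lt_right h
    · rw [if_neg h, if_neg (by omega), show i + 1 - P.n = i - P.n + 1 by omega]
      exact R.lt_succ _ (by omega)

lemma Partition.append_pt_left {a b c : ℝ} (P : Partition a b) (R : Partition b c) {i : ℕ}
    (hi : i ≤ P.n) : (P.append R).pt i = P.pt i := by
  simp only [Partition.append]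
  split_ifs with h
  · rfl
  · obtain rfl : i = P.n := by omega
    rw [Nat.sub_self, R.pt_zero, P.pt_last]

lemma Partition.append_pt_right {a b c : ℝ} (P : Partition a b) (R : Partition b c) (i : ℕ) :
    (P.append R).pt (P.n + i) = R.pt i := by
  simp [Partition.append]

lemma Partition.MeshLT.append {a b c δ : ℝ} {P : Partition a b} {R : Partition b c}
    (hP : P.MeshLT δ) (hR : R.MeshLT δ) : (P.append R).MeshLT δ := by
  intro i hi
  have hi : i < P.n + R.n := hi
  rcases lt_or_ge i P.n with h | h
  · rw [P.append_pt_left R h.le, P.append_pt_left R h]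
    exact hP i h
  · obtain ⟨j, rfl⟩ := Nat.exists_eq_add_of_le h
    rw [add_assoc, P.append_pt_right, P.append_pt_right]
    exact hR j (by omega)

lemma Partition.sum_append {a b c : ℝ} {V : Type*} [AddCommMonoid V] (P : Partition a b)
    (R : Partition b c) (f : ℝ → ℝ → V) :
    ∑ i ∈ Finset.range (P.append R).n, f ((P.append R).pt i) ((P.append R).pt (i + 1)) =
      ∑ i ∈ Finset.range P.n, f (P.pt i) (P.pt (i + 1)) +
        ∑ i ∈ Finset.range R.n, f (R.pt i) (R.pt (i + 1)) := by
  change ∑ i ∈ Finset.range (P.n + R.n), _ = _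
  rw [Finset.sum_range_add]
  congr 1
  · refine Finset.sum_congr rfl fun i hi => ?_
    have hi := Finset.mem_range.1 hi
    rw [P.append_pt_left R hi.le, P.append_pt_left R hi]
  · refine Finset.sum_congr rfl fun i _ => ?_
    rw [add_assoc, P.append_pt_right, P.append_pt_right]

/-! ### Convergence of one-dimensional Young sums -/

section Young

variable {𝕜 E : Type*} [RCLike 𝕜] [NormedAddCommGroup E] [NormedSpace 𝕜 E]

/-- The Young sums of `F` against `α`-Hölder integrators on `[s, t]` are bounded, and are Cauchy as
the mesh tends to zero, both uniformly with respect to the Hölder constant of the integrator. -/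
def YoungIntegrable (F : ℝ → E →L[𝕜] E) (α s t : ℝ) : Prop :=
  (∃ B : ℝ, 0 ≤ B ∧ SumBound F α s t B) ∧
    ∀ ε : ℝ, 0 < ε → ∃ δ : ℝ, 0 < δ ∧ ∀ (X : ℝ → E) (M : ℝ), 0 ≤ M → HolderIncr X α M s t →
      ∀ P P' : Partition s t, P.MeshLT δ → P'.MeshLT δ →
        ‖youngSum F X P.pt 0 P.n - youngSum F X P'.pt 0 P'.n‖ ≤ ε * M

/-- The Young sum over a refinement, grouped by the intervals of the coarse partition. Here `φ`
gives the index in `R` of the points of `P`. -/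
lemma Partition.Refines.youngSum_eq {F : ℝ → E →L[𝕜] E} {X : ℝ → E} {s t : ℝ}
    {R P : Partition s t} {φ : ℕ → ℕ} (h0 : φ 0 = 0)
    (hn : φ P.n = R.n) (hφ : ∀ i, i < P.n → φ i ≤ φ (i + 1)) :
    youngSum F X R.pt 0 R.n =
      ∑ i ∈ Finset.range P.n, youngSum F X R.pt (φ i) (φ (i + 1)) := by
  have H : ∀ m, m ≤ P.n → φ 0 ≤ φ m ∧ youngSum F X R.pt (φ 0) (φ m) =
      ∑ i ∈ Finset.range m, youngSum F X R.pt (φ i) (φ (i + 1)) := by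
    intro m
    induction m with
    | zero => intro _; simp [youngSum]
    | succ m ih =>
      intro hm
      obtain ⟨h1, h2⟩ := ih (by omega)
      refine ⟨h1.trans (hφ m hm), ?_⟩
      rw [Finset.sum_range_succ, ← h2]
      exact (Finset.sum_Ico_consecutive _ h1 (hφ m hm)).symm
  rw [← (H P.n le_rfl).2, h0, hn]

/-- Passing to a refinement changes the Young sum by a positive power of the mesh: the errors on
the intervals of the coarse partition are controlled by a power larger than one of an additive
control, and hence sum up to a small quantity. -/
lemma SingIncr.norm_youngSum_sub_refine_le {F : ℝ → E →L[𝕜] E} {X : ℝ → E} {s t τ γ θ A α M δ : ℝ}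
    (hF : SingIncr F s τ γ θ A) (hα : 0 ≤ α) (hθ : 0 ≤ θ) (hβ : 1 < θ + α) (hγ : 0 ≤ θ + γ)
    (hτ : t ≤ τ) (hγα : γ < α) (hM : 0 ≤ M) (hX : HolderIncr X α M s t)
    {R P : Partition s t} (hR : R.Refines P) (hP : P.MeshLT δ) :
    ‖youngSum F X R.pt 0 R.n - youngSum F X P.pt 0 P.n‖ ≤
      sewConst (θ + α) * (A * 2 ^ (θ + γ) * M) *
        ((δ ^ ((α - γ) / (θ + α)) / ((α - γ) / (θ + α))) ^ (θ + α - 1) *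
          (singWeight τ ((α - γ) / (θ + α)) t - singWeight τ ((α - γ) / (θ + α)) s)) := by
  obtain ⟨φ, h0, hn, hφ, hRP⟩ := hR.exists_index
  have hβ0 : 0 < θ + α := by linarith
  have hA := hF.nonneg
  have hS := sewConst_pos hβ
  set σ := (α - γ) / (θ + α) with hσ
  have hσ0 : 0 < σ := div_pos (by linarith) hβ0
  have hσ1 : σ ≤ 1 := by rw [hσ, div_le_one hβ0]; linarith
  rw [Partition.Refines.youngSum_eq h0 hn hφ, youngSum, ← Finset.range_eq_Ico,
    ← Finset.sum_sub_distrib]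
  refine (norm_sum_le _ _).trans ?_
  set w := singWeight τ σ with hw
  have hterm : ∀ i ∈ Finset.range P.n, ‖youngSum F X R.pt (φ i) (φ (i + 1)) -
      F (P.pt i) (X (P.pt (i + 1)) - X (P.pt i))‖ ≤
      sewConst (θ + α) * (A * 2 ^ (θ + γ) * M) * ((δ ^ σ / σ) ^ (θ + α - 1) *
        (w (P.pt (i + 1)) - w (P.pt i))) := by
    intro i hi
    have hi := Finset.mem_range.1 hi
    have h := hF.norm_youngSum_sub_le hα hθ hβ hγ hτ (Or.inl hγα) hM hX (p := R.pt) (N := R.n)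
      (fun i j hij hj => R.pt_le hij hj) R.pt_zero.ge R.pt_last.le (hφ i hi) (hRP (i + 1) hi).1
    rw [(hRP i hi.le).2, (hRP (i + 1) hi).2] at h
    refine h.trans ?_
    have hlt := P.lt_succ i hi
    have hle : P.pt (i + 1) ≤ τ := (P.le_right hi).trans hτ
    have hpow := singWeight_sub_le_rpow hσ0 hσ1 hlt.le hle
    have hmono := singWeight_mono hσ0.ne' hσ1 hlt.le hle (Or.inl hσ0)
    have hU : 0 ≤ w (P.pt (i + 1)) - w (P.pt i) := by linarith
    have hUδ : w (P.pt (i + 1)) - w (P.pt i) ≤ δ ^ σ / σ := by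
      refine hpow.trans ?_
      have := hP i hi
      gcongr
    refine mul_le_mul_of_nonneg_left ?_ (by positivity)
    calc (w (P.pt (i + 1)) - w (P.pt i)) ^ (θ + α)
        = (w (P.pt (i + 1)) - w (P.pt i)) ^ (θ + α - 1) * (w (P.pt (i + 1)) - w (P.pt i)) := by
          conv_lhs => rw [← sub_add_cancel (θ + α) 1]
          rw [Real.rpow_add_of_nonneg hU (by linarith) zero_le_one, Real.rpow_one]
      _ ≤ _ := by
          refine mul_le_mul_of_nonneg_right ?_ hU
          exact Real.rpow_le_rpow hU hUδ (by linarith)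
  refine (Finset.sum_le_sum hterm).trans_eq ?_
  rw [← Finset.mul_sum, ← Finset.mul_sum, Finset.sum_range_sub (fun i => w (P.pt i)), P.pt_zero,
    P.pt_last]

lemma SingIncr.youngIntegrable {F : ℝ → E →L[𝕜] E} {s t τ γ θ A α : ℝ}
    (hF : SingIncr F s τ γ θ A) (hα : 0 ≤ α) (hθ : 0 ≤ θ) (hβ : 1 < θ + α) (hγ : 0 ≤ θ + γ)
    (hτ : t ≤ τ) (hγα : γ < α) : YoungIntegrable F α s t := by
  have hA := hF.nonneg
  have hβ0 : 0 < θ + α := by linarith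
  constructor
  · have hc := singConst_nonneg (γ := γ) hβ
    rcases lt_or_ge t s with hts | hst
    · exact ⟨0, le_rfl, fun X M _ _ P => absurd P.le (not_le.2 hts)⟩
    have hts : 0 ≤ t - s := by linarith
    refine ⟨singConst θ α γ * A * (t - s) ^ (α - γ) + ‖F s‖ * (t - s) ^ α, by positivity, ?_⟩
    intro X M hM hX P
    have h := hF.norm_youngSum_sub_le_of_lt hα hθ hβ hγ hτ hγα hM hX (p := P.pt) (N := P.n)
      (fun i j hij hj => P.pt_le hij hj) P.pt_zero.ge P.pt_last.le (Nat.zero_le _) le_rfl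
    rw [P.pt_zero, P.pt_last] at h
    have h2 : ‖F s (X t - X s)‖ ≤ ‖F s‖ * (M * (t - s) ^ α) :=
      ((F s).le_opNorm _).trans (by gcongr; exact hX s t le_rfl hst le_rfl)
    calc ‖youngSum F X P.pt 0 P.n‖ ≤ ‖youngSum F X P.pt 0 P.n - F s (X t - X s)‖ +
          ‖F s (X t - X s)‖ := by
          simpa using norm_add_le (youngSum F X P.pt 0 P.n - F s (X t - X s)) (F s (X t - X s))
      _ ≤ _ := (add_le_add h h2).trans_eq (by ring)
  · intro ε hε
    set σ := (α - γ) / (θ + α) with hσ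
    have hσ0 : 0 < σ := div_pos (by linarith) hβ0
    set c := sewConst (θ + α) * (A * 2 ^ (θ + γ)) * (singWeight τ σ t - singWeight τ σ s) with hc
    -- the error bound tends to zero with the mesh
    have hlim : Filter.Tendsto (fun δ : ℝ => 2 * (c * (δ ^ σ / σ) ^ (θ + α - 1)))
        (nhds 0) (nhds 0) := by
      have hcont : ContinuousAt (fun δ : ℝ => 2 * (c * (δ ^ σ / σ) ^ (θ + α - 1))) 0 := by
        have h1 : ContinuousAt (fun δ : ℝ => δ ^ σ) 0 :=
          Real.continuousAt_rpow_const _ _ (Or.inr hσ0.le)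
        exact (((h1.div_const σ).rpow_const (Or.inr (by linarith))).const_mul c).const_mul 2
      have := hcont.tendsto
      simpa [Real.zero_rpow hσ0.ne', Real.zero_rpow (show θ + α - 1 ≠ 0 by linarith)] using this
    have hev := (hlim.mono_left (nhdsWithin_le_nhds (s := Set.Ioi 0))).eventually
      (gt_mem_nhds hε)
    obtain ⟨δ, hδε, hδ⟩ := (hev.and self_mem_nhdsWithin).exists
    have hδ : 0 < δ := hδ
    refine ⟨δ, hδ, fun X M hM hX P P' hP hP' => ?_⟩
    obtain ⟨R, hR, hR'⟩ := exists_common_refinement P P'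
    have h1 := hF.norm_youngSum_sub_refine_le hα hθ hβ hγ hτ hγα hM hX hR hP
    have h2 := hF.norm_youngSum_sub_refine_le hα hθ hβ hγ hτ hγα hM hX hR' hP'
    have h3 : youngSum F X P.pt 0 P.n - youngSum F X P'.pt 0 P'.n =
        (youngSum F X R.pt 0 R.n - youngSum F X P'.pt 0 P'.n) -
        (youngSum F X R.pt 0 R.n - youngSum F X P.pt 0 P.n) := by abel
    rw [h3]
    refine (norm_sub_le _ _).trans ((add_le_add h2 h1).trans ?_)
    calc _ = 2 * (c * (δ ^ σ / σ) ^ (θ + α - 1)) * M := by rw [hc]; ring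
      _ ≤ ε * M := by gcongr

end Young

/-! ### Double integrals of operator functions -/

section Double

variable {𝕜 H : Type*} [RCLike 𝕜] [NormedAddCommGroup H] [InnerProductSpace 𝕜 H]

/-- Left composition with an operator, as an operator on `H →L[𝕜] H`. -/
noncomputable def leftComp (A : H →L[𝕜] H) : (H →L[𝕜] H) →L[𝕜] (H →L[𝕜] H) :=
  ContinuousLinearMap.compL 𝕜 H H H A

/-- Right composition with an operator, as an operator on `H →L[𝕜] H`. -/
noncomputable def rightComp (A : H →L[𝕜] H) : (H →L[𝕜] H) →L[𝕜] (H →L[𝕜] H) :=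
  (ContinuousLinearMap.compL 𝕜 H H H).flip A

lemma leftComp_apply (A B : H →L[𝕜] H) : leftComp A B = A.comp B := rfl

lemma rightComp_apply (A B : H →L[𝕜] H) : rightComp A B = B.comp A := rfl

lemma norm_leftComp_sub_le (A B : H →L[𝕜] H) : ‖leftComp A - leftComp B‖ ≤ ‖A - B‖ :=
  ContinuousLinearMap.opNorm_le_bound _ (norm_nonneg _) fun C => by
    rw [sub_apply, leftComp_apply, leftComp_apply, ← ContinuousLinearMap.sub_comp]
    exact ContinuousLinearMap.opNorm_comp_le _ _

lemma norm_rightComp_sub_le (A B : H →L[𝕜] H) : ‖rightComp A - rightComp B‖ ≤ ‖A - B‖ :=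
  ContinuousLinearMap.opNorm_le_bound _ (norm_nonneg _) fun C => by
    rw [sub_apply, rightComp_apply, rightComp_apply, ← ContinuousLinearMap.comp_sub, mul_comm]
    exact ContinuousLinearMap.opNorm_comp_le _ _

/-- The double Riemann sum is an iterated one-dimensional Young sum. -/
lemma riemannSum_eq (F : ℝ → H →L[𝕜] H) (Q : ℝ → ℝ → H →L[𝕜] H) (G : ℝ → H →L[𝕜] H)
    {s t s' t' : ℝ} (P : Partition s t) (P' : Partition s' t') :
    riemannSum F Q G P P' = youngSum (fun r => leftComp (F r))
      (fun u => youngSum (fun r => rightComp (G r)) (Q u) P'.pt 0 P'.n) P.pt 0 P.n := by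
  simp only [riemannSum, youngSum, Finset.range_eq_Ico, leftComp_apply, rightComp_apply]
  refine Finset.sum_congr rfl fun i _ => ?_
  rw [← Finset.sum_sub_distrib, ContinuousLinearMap.comp_finsetSum]
  refine Finset.sum_congr rfl fun j _ => ?_
  rw [← ContinuousLinearMap.sub_comp]
  congr 2
  rw [rectInc]; abel

/-- The bound on rectangular increments expressing that `Q` is `α`-regular on
`[s, t] × [s', t']`. -/
def RectHolder (Q : ℝ → ℝ → H →L[𝕜] H) (α N s t s' t' : ℝ) : Prop :=
  ∀ a b a' b', s ≤ a → a ≤ b → b ≤ t → s' ≤ a' → a' ≤ b' → b' ≤ t' →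
    ‖rectInc Q a a' b b'‖ ≤ N * ((b - a) ^ α * (b' - a') ^ α)

lemma youngSum_sub {E : Type*} [NormedAddCommGroup E] [NormedSpace 𝕜 E] (F : ℝ → E →L[𝕜] E)
    (X Y : ℝ → E) (p : ℕ → ℝ) (i j : ℕ) :
    youngSum F X p i j - youngSum F Y p i j = youngSum F (fun r => X r - Y r) p i j := by
  simp only [youngSum]
  rw [← Finset.sum_sub_distrib]
  refine Finset.sum_congr rfl fun k _ => ?_
  rw [← map_sub]
  congr 1; abel

lemma RectHolder.holderIncr_sub {Q : ℝ → ℝ → H →L[𝕜] H} {α N s t s' t' : ℝ}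
    (hQ : RectHolder Q α N s t s' t') {a b : ℝ} (ha : s ≤ a) (hab : a ≤ b) (hb : b ≤ t) :
    HolderIncr (fun r => Q b r - Q a r) α (N * (b - a) ^ α) s' t' := by
  intro a' b' ha' hab' hb'
  have h := hQ a b a' b' ha hab hb ha' hab' hb'
  have e : rectInc Q a a' b b' = Q b b' - Q a b' - (Q b a' - Q a a') := by rw [rectInc]; abel
  rw [e] at h
  exact h.trans_eq (by ring)

/-- Young sums in the second variable are Hölder continuous in the first variable. -/
lemma RectHolder.holderIncr_youngSum {Q : ℝ → ℝ → H →L[𝕜] H} {G : ℝ → H →L[𝕜] H}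
    {α N s t s' t' B : ℝ} (hQ : RectHolder Q α N s t s' t') (hN : 0 ≤ N)
    (hG : SumBound (fun r => rightComp (G r)) α s' t' B) (P' : Partition s' t') :
    HolderIncr (fun u => youngSum (fun r => rightComp (G r)) (Q u) P'.pt 0 P'.n) α (B * N) s t := by
  intro a b ha hab hb
  have hba : 0 ≤ (b - a) ^ α := Real.rpow_nonneg (by linarith) _
  simp only [youngSum_sub]
  exact (hG _ _ (mul_nonneg hN hba) (hQ.holderIncr_sub ha hab hb) P').trans_eq (by ring)

lemma norm_riemannSum_le {F G : ℝ → H →L[𝕜] H} {Q : ℝ → ℝ → H →L[𝕜] H}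
    {α N s t s' t' B B' : ℝ} (hQ : RectHolder Q α N s t s' t') (hN : 0 ≤ N) (hB' : 0 ≤ B')
    (hF : SumBound (fun r => leftComp (F r)) α s t B)
    (hG : SumBound (fun r => rightComp (G r)) α s' t' B')
    (P : Partition s t) (P' : Partition s' t') : ‖riemannSum F Q G P P'‖ ≤ B * (B' * N) := by
  rw [riemannSum_eq]
  exact hF _ _ (mul_nonneg hB' hN) (hQ.holderIncr_youngSum hN hG P') P

lemma exists_riemannSum_sub_le {F G : ℝ → H →L[𝕜] H} {Q : ℝ → ℝ → H →L[𝕜] H}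
    {α N s t s' t' : ℝ} (hQ : RectHolder Q α N s t s' t') (hN : 0 ≤ N)
    (hF : YoungIntegrable (fun r => leftComp (F r)) α s t)
    (hG : YoungIntegrable (fun r => rightComp (G r)) α s' t') {ε : ℝ} (hε : 0 < ε) :
    ∃ δ : ℝ, 0 < δ ∧ ∀ (P R : Partition s t) (P' R' : Partition s' t'),
      P.MeshLT δ → R.MeshLT δ → P'.MeshLT δ → R'.MeshLT δ →
        ‖riemannSum F Q G P P' - riemannSum F Q G R R'‖ ≤ ε := by
  obtain ⟨⟨B, hB0, hB⟩, hFc⟩ := hF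
  obtain ⟨⟨B', hB0', hB'⟩, hGc⟩ := hG
  obtain ⟨δ₁, hδ₁, h₁⟩ := hFc (ε / 2 / (B' * N + 1)) (by positivity)
  obtain ⟨δ₂, hδ₂, h₂⟩ := hGc (ε / 2 / (B * N + 1)) (by positivity)
  refine ⟨min δ₁ δ₂, lt_min hδ₁ hδ₂, fun P R P' R' hP hR hP' hR' => ?_⟩
  have hm : ∀ {a b δ : ℝ} {S : Partition a b} {δ' : ℝ}, S.MeshLT δ → δ ≤ δ' → S.MeshLT δ' :=
    fun h hle i hi => (h i hi).trans_le hle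
  simp only [riemannSum_eq]
  set Y := fun u => youngSum (fun r => rightComp (G r)) (Q u) P'.pt 0 P'.n with hY
  set Z := fun u => youngSum (fun r => rightComp (G r)) (Q u) R'.pt 0 R'.n with hZ
  have e1 := h₁ Y (B' * N) (by positivity) (hQ.holderIncr_youngSum hN hB' P') P R
    (hm hP (min_le_left _ _)) (hm hR (min_le_left _ _))
  have hYZ : HolderIncr (fun u => Y u - Z u) α (ε / 2 / (B * N + 1) * N) s t := by
    intro a b ha hab hb
    have hba : 0 ≤ (b - a) ^ α := Real.rpow_nonneg (by linarith) _
    have h := h₂ _ _ (mul_nonneg hN hba) (hQ.holderIncr_sub ha hab hb) P' R'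
      (hm hP' (min_le_right _ _)) (hm hR' (min_le_right _ _))
    rw [← youngSum_sub, ← youngSum_sub] at h
    have e : Y b - Z b - (Y a - Z a) = Y b - Y a - (Z b - Z a) := by abel
    simp only [e]
    exact h.trans_eq (by ring)
  have e2 := hB _ _ (by positivity) hYZ R
  rw [← youngSum_sub] at e2
  have h1 : ε / 2 / (B' * N + 1) * (B' * N) ≤ ε / 2 := by
    rw [div_mul_eq_mul_div, div_le_iff₀ (by positivity)]
    nlinarith
  have h2 : B * (ε / 2 / (B * N + 1) * N) ≤ ε / 2 := by
    rw [show B * (ε / 2 / (B * N + 1) * N) = ε / 2 * (B * N) / (B * N + 1) by ring,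
      div_le_iff₀ (by positivity)]
    nlinarith
  calc _ ≤ _ := norm_sub_le_norm_sub_add_norm_sub _
          (youngSum (fun r => leftComp (F r)) Y R.pt 0 R.n) _
    _ ≤ ε / 2 + ε / 2 := add_le_add (e1.trans h1) (e2.trans h2)
    _ = ε := by ring

lemma exists_hasDoubleIntegral [CompleteSpace H] {F G : ℝ → H →L[𝕜] H} {Q : ℝ → ℝ → H →L[𝕜] H}
    {α N s t s' t' : ℝ} (hst : s ≤ t) (hst' : s' ≤ t') (hQ : RectHolder Q α N s t s' t')
    (hN : 0 ≤ N) (hF : YoungIntegrable (fun r => leftComp (F r)) α s t)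
    (hG : YoungIntegrable (fun r => rightComp (G r)) α s' t') :
    ∃ J, HasDoubleIntegral F Q G s t s' t' J := by
  choose P hP using fun n : ℕ =>
    exists_partition_meshLT hst (show (0 : ℝ) < 1 / ((n : ℝ) + 1) by positivity)
  choose P' hP' using fun n : ℕ =>
    exists_partition_meshLT hst' (show (0 : ℝ) < 1 / ((n : ℝ) + 1) by positivity)
  have hsmall : ∀ {δ : ℝ}, 0 < δ → ∃ n₀ : ℕ, ∀ n ≥ n₀, (P n).MeshLT δ ∧ (P' n).MeshLT δ := by
    intro δ hδ
    obtain ⟨n₀, hn₀⟩ := exists_nat_one_div_lt hδ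
    refine ⟨n₀, fun n hn => ?_⟩
    have : 1 / ((n : ℝ) + 1) ≤ δ := (Nat.one_div_le_one_div hn).trans hn₀.le
    exact ⟨fun i hi => (hP n i hi).trans_le this, fun i hi => (hP' n i hi).trans_le this⟩
  have hcauchy : CauchySeq fun n => riemannSum F Q G (P n) (P' n) := by
    refine Metric.cauchySeq_iff'.2 fun ε hε => ?_
    obtain ⟨δ, hδ, h⟩ := exists_riemannSum_sub_le hQ hN hF hG (half_pos hε)
    obtain ⟨n₀, hn₀⟩ := hsmall hδ
    refine ⟨n₀, fun n hn => ?_⟩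
    rw [dist_eq_norm]
    refine (h _ _ _ _ (hn₀ n hn).1 (hn₀ n₀ le_rfl).1 (hn₀ n hn).2 (hn₀ n₀ le_rfl).2).trans_lt ?_
    linarith
  obtain ⟨J, hJ⟩ := cauchySeq_tendsto_of_complete hcauchy
  refine ⟨J, fun ε hε => ?_⟩
  obtain ⟨δ, hδ, h⟩ := exists_riemannSum_sub_le hQ hN hF hG (half_pos hε)
  obtain ⟨n₀, hn₀⟩ := hsmall hδ
  refine ⟨δ, hδ, fun R R' hR hR' => ?_⟩
  have hlim : Filter.Tendsto (fun n => ‖riemannSum F Q G R R' - riemannSum F Q G (P n) (P' n)‖)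
      Filter.atTop (nhds ‖riemannSum F Q G R R' - J‖) := (hJ.const_sub _).norm
  refine (le_of_tendsto hlim (Filter.eventually_atTop.2 ⟨n₀, fun n hn =>
    h _ _ _ _ hR (hn₀ n hn).1 hR' (hn₀ n hn).2⟩)).trans_lt ?_
  linarith

/-- The mesh bound in the definition of the double integral may be decreased. -/
lemma HasDoubleIntegral.exists_close {F G : ℝ → H →L[𝕜] H} {Q : ℝ → ℝ → H →L[𝕜] H}
    {s t s' t' : ℝ} {J : H →L[𝕜] H} (h : HasDoubleIntegral F Q G s t s' t' J) {ε : ℝ}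
    (hε : 0 < ε) : ∃ δ₀ : ℝ, 0 < δ₀ ∧ ∀ δ, δ ≤ δ₀ → ∀ (P : Partition s t) (P' : Partition s' t'),
      P.MeshLT δ → P'.MeshLT δ → ‖riemannSum F Q G P P' - J‖ < ε := by
  obtain ⟨δ₀, hδ₀, h⟩ := h ε hε
  exact ⟨δ₀, hδ₀, fun δ hδ P P' hP hP' =>
    h P P' (fun i hi => (hP i hi).trans_le hδ) (fun i hi => (hP' i hi).trans_le hδ)⟩

lemma HasDoubleIntegral.norm_le {F G : ℝ → H →L[𝕜] H} {Q : ℝ → ℝ → H →L[𝕜] H}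
    {s t s' t' : ℝ} {J : H →L[𝕜] H} (h : HasDoubleIntegral F Q G s t s' t' J) (hst : s ≤ t)
    (hst' : s' ≤ t') {B : ℝ}
    (hB : ∀ (P : Partition s t) (P' : Partition s' t'), ‖riemannSum F Q G P P'‖ ≤ B) :
    ‖J‖ ≤ B := by
  refine le_of_forall_pos_le_add fun ε hε => ?_
  obtain ⟨δ, hδ, h⟩ := h ε hε
  obtain ⟨P, hP⟩ := exists_partition_meshLT hst hδ
  obtain ⟨P', hP'⟩ := exists_partition_meshLT hst' hδ
  have h1 := h P P' hP hP'
  have h2 := norm_sub_norm_le J (riemannSum F Q G P P')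
  rw [norm_sub_rev] at h2
  linarith [hB P P']

lemma HasDoubleIntegral.unique {F G : ℝ → H →L[𝕜] H} {Q : ℝ → ℝ → H →L[𝕜] H}
    {s t s' t' : ℝ} {J J' : H →L[𝕜] H} (h : HasDoubleIntegral F Q G s t s' t' J)
    (h' : HasDoubleIntegral F Q G s t s' t' J') (hst : s ≤ t) (hst' : s' ≤ t') : J = J' := by
  refine sub_eq_zero.1 (norm_le_zero_iff.1 (le_of_forall_pos_le_add fun ε hε => ?_))
  obtain ⟨δ₁, hδ₁, h₁⟩ := h.exists_close (half_pos hε)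
  obtain ⟨δ₂, hδ₂, h₂⟩ := h'.exists_close (half_pos hε)
  obtain ⟨P, hP⟩ := exists_partition_meshLT hst (lt_min hδ₁ hδ₂)
  obtain ⟨P', hP'⟩ := exists_partition_meshLT hst' (lt_min hδ₁ hδ₂)
  have a1 := h₁ _ (min_le_left _ _) P P' hP hP'
  have a2 := h₂ _ (min_le_right _ _) P P' hP hP'
  have a3 := norm_sub_le_norm_sub_add_norm_sub J (riemannSum F Q G P P') J'
  rw [norm_sub_rev J (riemannSum F Q G P P')] at a3
  linarith

lemma riemannSum_append_left (F : ℝ → H →L[𝕜] H) (Q : ℝ → ℝ → H →L[𝕜] H) (G : ℝ → H →L[𝕜] H)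
    {a b c s' t' : ℝ} (P : Partition a b) (R : Partition b c) (P' : Partition s' t') :
    riemannSum F Q G (P.append R) P' = riemannSum F Q G P P' + riemannSum F Q G R P' :=
  P.sum_append R fun u v => ∑ j ∈ Finset.range P'.n, (F u).comp
    ((rectInc Q u (P'.pt j) v (P'.pt (j + 1))).comp (G (P'.pt j)))

lemma riemannSum_append_right (F : ℝ → H →L[𝕜] H) (Q : ℝ → ℝ → H →L[𝕜] H) (G : ℝ → H →L[𝕜] H)
    {a b c s t : ℝ} (S : Partition s t) (P : Partition a b) (R : Partition b c) :
    riemannSum F Q G S (P.append R) = riemannSum F Q G S P + riemannSum F Q G S R := by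
  simp only [riemannSum]
  rw [← Finset.sum_add_distrib]
  refine Finset.sum_congr rfl fun i _ => ?_
  exact P.sum_append R fun u v => (F (S.pt i)).comp
    ((rectInc Q (S.pt i) u (S.pt (i + 1)) v).comp (G u))

lemma HasDoubleIntegral.eq_add_left {F G : ℝ → H →L[𝕜] H} {Q : ℝ → ℝ → H →L[𝕜] H}
    {a b c s' t' : ℝ} {J J₁ J₂ : H →L[𝕜] H} (hab : a ≤ b) (hbc : b ≤ c) (hst' : s' ≤ t')
    (h : HasDoubleIntegral F Q G a c s' t' J) (h₁ : HasDoubleIntegral F Q G a b s' t' J₁)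
    (h₂ : HasDoubleIntegral F Q G b c s' t' J₂) : J = J₁ + J₂ := by
  refine sub_eq_zero.1 (norm_le_zero_iff.1 (le_of_forall_pos_le_add fun ε hε => ?_))
  have hε3 : 0 < ε / 3 := by linarith
  obtain ⟨δ₀, hδ₀, h⟩ := h.exists_close hε3
  obtain ⟨δ₁, hδ₁, h₁⟩ := h₁.exists_close hε3
  obtain ⟨δ₂, hδ₂, h₂⟩ := h₂.exists_close hε3
  have hδ := lt_min hδ₀ (lt_min hδ₁ hδ₂)
  obtain ⟨P, hP⟩ := exists_partition_meshLT hab hδ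
  obtain ⟨R, hR⟩ := exists_partition_meshLT hbc hδ
  obtain ⟨P', hP'⟩ := exists_partition_meshLT hst' hδ
  have a0 := h _ (min_le_left _ _) _ P' (hP.append hR) hP'
  have a1 := h₁ _ ((min_le_right _ _).trans (min_le_left _ _)) P P' hP hP'
  have a2 := h₂ _ ((min_le_right _ _).trans (min_le_right _ _)) R P' hR hP'
  rw [riemannSum_append_left] at a0
  have e : J - (J₁ + J₂) = (riemannSum F Q G P P' - J₁) + (riemannSum F Q G R P' - J₂) -
      (riemannSum F Q G P P' + riemannSum F Q G R P' - J) := by abel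
  rw [e]
  refine (norm_sub_le _ _).trans ?_
  linarith [norm_add_le (riemannSum F Q G P P' - J₁) (riemannSum F Q G R P' - J₂)]

lemma HasDoubleIntegral.eq_add_right {F G : ℝ → H →L[𝕜] H} {Q : ℝ → ℝ → H →L[𝕜] H}
    {a b c s t : ℝ} {J J₁ J₂ : H →L[𝕜] H} (hst : s ≤ t) (hab : a ≤ b) (hbc : b ≤ c)
    (h : HasDoubleIntegral F Q G s t a c J) (h₁ : HasDoubleIntegral F Q G s t a b J₁)
    (h₂ : HasDoubleIntegral F Q G s t b c J₂) : J = J₁ + J₂ := by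
  refine sub_eq_zero.1 (norm_le_zero_iff.1 (le_of_forall_pos_le_add fun ε hε => ?_))
  have hε3 : 0 < ε / 3 := by linarith
  obtain ⟨δ₀, hδ₀, h⟩ := h.exists_close hε3
  obtain ⟨δ₁, hδ₁, h₁⟩ := h₁.exists_close hε3
  obtain ⟨δ₂, hδ₂, h₂⟩ := h₂.exists_close hε3
  have hδ := lt_min hδ₀ (lt_min hδ₁ hδ₂)
  obtain ⟨S, hS⟩ := exists_partition_meshLT hst hδ
  obtain ⟨P, hP⟩ := exists_partition_meshLT hab hδ
  obtain ⟨R, hR⟩ := exists_partition_meshLT hbc hδ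
  have a0 := h _ (min_le_left _ _) S _ hS (hP.append hR)
  have a1 := h₁ _ ((min_le_right _ _).trans (min_le_left _ _)) S P hS hP
  have a2 := h₂ _ ((min_le_right _ _).trans (min_le_right _ _)) S R hS hR
  rw [riemannSum_append_right] at a0
  have e : J - (J₁ + J₂) = (riemannSum F Q G S P - J₁) + (riemannSum F Q G S R - J₂) -
      (riemannSum F Q G S P + riemannSum F Q G S R - J) := by abel
  rw [e]
  refine (norm_sub_le _ _).trans ?_
  linarith [norm_add_le (riemannSum F Q G S P - J₁) (riemannSum F Q G S R - J₂)]

end Double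

/-! ### Bounds with values in `[0, ∞]` -/

section Extended

variable {𝕜 E : Type*} [RCLike 𝕜] [NormedAddCommGroup E] [NormedSpace 𝕜 E]

/-- `SumBound` with an extended constant; nothing is required if the constant is `∞`. -/
def SumBoundE (F : ℝ → E →L[𝕜] E) (α s t : ℝ) (B : ℝ≥0∞) : Prop :=
  ∀ b : ℝ≥0, B ≤ b → SumBound F α s t b

/-- The hypothesis `h0` takes care of the product `0 * ∞ = 0`. -/
lemma sumBoundE_mul {F : ℝ → E →L[𝕜] E} {α s t : ℝ} {c : ℝ≥0} {N x : ℝ≥0∞} (hc : 0 < c)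
    (h0 : N = 0 → SumBound F α s t 0)
    (h : x ≠ ∞ → SumBound F α s t (c * N.toReal * x.toReal)) :
    SumBoundE F α s t (c * N * x) := by
  intro b hb
  by_cases hx : x = ∞
  · have hN0 : N = 0 := by
      by_contra hne
      rw [hx, ENNReal.mul_top (mul_ne_zero (by exact_mod_cast hc.ne') hne)] at hb
      exact ENNReal.coe_ne_top (top_le_iff.1 hb)
    exact (h0 hN0).mono b.2
  · refine (h hx).mono ?_
    have := ENNReal.toReal_mono ENNReal.coe_ne_top hb
    simpa [ENNReal.toReal_mul] using this

lemma enorm_rpow_eq {x p : ℝ} (hx : 0 ≤ x) (h : 0 < x ∨ 0 ≤ p) :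
    ‖x‖ₑ ^ p = ENNReal.ofReal (x ^ p) := by
  rw [Real.enorm_of_nonneg hx]
  rcases h with h | h
  · exact ENNReal.ofReal_rpow_of_pos h
  · exact ENNReal.ofReal_rpow_of_nonneg hx h

lemma SingIncr.sumBound_zero {F : ℝ → E →L[𝕜] E} {s t τ γ θ α : ℝ}
    (hF : SingIncr F s τ γ θ 0) (hτ : t ≤ τ) (hFs : F s = 0) : SumBound F α s t 0 := by
  refine sumBound_of_eq_zero (fun r h1 h2 => ?_) le_rfl
  simpa [hFs] using hF.le_rpow s r le_rfl h1 (by linarith)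

lemma sumBound_self {F : ℝ → E →L[𝕜] E} {α s B : ℝ} (hB : 0 ≤ B) : SumBound F α s s B :=
  sumBound_of_eq_zero (fun _ h1 h2 => absurd h1 (not_le.2 h2)) hB

/-- The constant in all one-dimensional estimates. -/
noncomputable def totalConst (θ α η : ℝ) : ℝ≥0 :=
  Real.toNNReal (sewConst (θ + α) + (singConst θ α η + singConst θ α (η + 1) + 2))

variable {F : ℝ → E →L[𝕜] E} {s t τ η θ D α ζ ϑ : ℝ} {N : ℝ≥0∞}

lemma coe_totalConst (hβ : 1 < θ + α) : (totalConst θ α η : ℝ) =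
    sewConst (θ + α) + (singConst θ α η + singConst θ α (η + 1) + 2) :=
  Real.coe_toNNReal _ (by
    linarith [sewConst_pos hβ, singConst_nonneg (γ := η) hβ, singConst_nonneg (γ := η + 1) hβ])

lemma totalConst_pos (hβ : 1 < θ + α) : 0 < totalConst θ α η := by
  rw [← NNReal.coe_pos, coe_totalConst hβ]
  linarith [sewConst_pos hβ, singConst_nonneg (γ := η) hβ, singConst_nonneg (γ := η + 1) hβ]

lemma sewConst_le_totalConst (hβ : 1 < θ + α) : sewConst (θ + α) ≤ totalConst θ α η := by
  rw [coe_totalConst hβ]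
  linarith [singConst_nonneg (γ := η) hβ, singConst_nonneg (γ := η + 1) hβ]

lemma singConst_le_totalConst (hβ : 1 < θ + α) :
    singConst θ α η + singConst θ α (η + 1) + 2 ≤ totalConst θ α η := by
  rw [coe_totalConst hβ]
  linarith [sewConst_pos hβ]

lemma SingIncr.sumBoundE_regular (hF : SingIncr F s τ η θ N.toReal)
    (hα : 0 ≤ α) (hη : 0 ≤ η) (hθ : 0 < θ) (hβ : 1 < θ + α) (hst : s ≤ t)
    (hτ : t ≤ τ) (hFs : F s = 0) :
    SumBoundE F α s t (totalConst θ α η * N *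
      (‖τ - t‖ₑ ^ (-(θ + η)) * ‖t - s‖ₑ ^ (θ + α))) := by
  have hβ0 : 0 < θ + α := by linarith
  refine sumBoundE_mul (totalConst_pos hβ) (fun h => ?_) (fun hx => ?_)
  · rw [h] at hF; exact hF.sumBound_zero hτ hFs
  rcases hst.eq_or_lt with rfl | hlt
  · exact sumBound_self (by positivity)
  have hts : 0 < t - s := by linarith
  rcases hτ.eq_or_lt with rfl | hlt'
  · refine absurd ?_ hx
    rw [sub_self, enorm_zero, ENNReal.zero_rpow_of_neg (by linarith), ENNReal.top_mul]
    rw [enorm_rpow_eq hts.le (Or.inl hts)]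
    simp only [ne_eq, ENNReal.ofReal_eq_zero, not_le]
    positivity
  have hy : 0 < τ - t := by linarith
  refine (hF.sumBound_regular hα hθ.le hβ (by linarith) hlt' hFs).mono ?_
  rw [enorm_rpow_eq hy.le (Or.inl hy), enorm_rpow_eq hts.le (Or.inl hts), ENNReal.toReal_mul,
    ENNReal.toReal_ofReal (by positivity), ENNReal.toReal_ofReal (by positivity), neg_add',
    ← mul_assoc]
  gcongr
  exact sewConst_le_totalConst hβ

lemma SingIncr.sumBoundE_singular (hF : SingIncr F s τ η θ N.toReal)
    (hα : 0 ≤ α) (hη : 0 ≤ η) (hθ : 0 < θ) (hβ : 1 < θ + α) (hηα : η < α) (hst : s ≤ t)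
    (hτ : t ≤ τ) (hFs : F s = 0) :
    SumBoundE F α s t (totalConst θ α η * N * ‖τ - s‖ₑ ^ (θ + α - (θ + η))) := by
  refine sumBoundE_mul (totalConst_pos hβ) (fun h => ?_) (fun hx => ?_)
  · rw [h] at hF; exact hF.sumBound_zero hτ hFs
  have hL : 0 ≤ τ - s := by linarith
  rw [add_sub_add_left_eq_sub, enorm_rpow_eq hL (Or.inr (by linarith)),
    ENNReal.toReal_ofReal (by positivity)]
  refine (hF.sumBound_of_lt hα hθ.le hβ (by linarith) hτ hηα hFs).mono ?_
  have h1 : (t - s) ^ (α - η) ≤ (τ - s) ^ (α - η) :=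
    Real.rpow_le_rpow (by linarith) (by linarith) (by linarith)
  have h2 : singConst θ α η ≤ totalConst θ α η := by
    linarith [singConst_le_totalConst (η := η) hβ, singConst_nonneg (γ := η + 1) hβ]
  have h3 := singConst_nonneg (γ := η) hβ
  have h4 : 0 ≤ (t - s) ^ (α - η) := Real.rpow_nonneg (by linarith) _
  gcongr

lemma sumBound_zero_of_forall (hF : ∀ ν ∈ Set.Icc (0 : ℝ) 1,
    SingIncr F s τ (η + ν) θ (N.toReal * D ^ ν)) (hτ : t ≤ τ) (hFs : F s = 0)
    (h : N = 0 ∨ D = 0) : SumBound F α s t 0 := by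
  have h1 := hF 1 (by norm_num)
  have e : N.toReal * D ^ (1 : ℝ) = 0 := by
    rcases h with h | h <;> simp [h]
  rw [e] at h1
  exact h1.sumBound_zero hτ hFs

/-- The bound for rectangular increments of a kernel that degenerates as `t → τ`; here the
exponent `ν = ϑ` is used. -/
lemma sumBoundE_regular_of_forall (hF : ∀ ν ∈ Set.Icc (0 : ℝ) 1,
      SingIncr F s τ (η + ν) θ (N.toReal * D ^ ν))
    (hα : 0 ≤ α) (hη : 0 ≤ η) (hθ : 0 < θ) (hβ : 1 < θ + α) (hst : s ≤ t)
    (hτ : t ≤ τ) (hFs : F s = 0) (hD : 0 ≤ D) (hζ0 : 0 ≤ ζ) (hζϑ : ζ ≤ ϑ) (hϑ : ϑ ≤ 1) :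
    SumBoundE F α s t (totalConst θ α η * N *
      (‖D‖ₑ ^ ϑ * ‖τ - t‖ₑ ^ (-ϑ + ζ) *
        (‖τ - t‖ₑ ^ (-(θ + η) - ζ) * ‖t - s‖ₑ ^ (θ + α)))) := by
  have hβ0 : 0 < θ + α := by linarith
  refine sumBoundE_mul (totalConst_pos hβ)
    (fun h => sumBound_zero_of_forall hF hτ hFs (Or.inl h)) (fun hx => ?_)
  rcases hst.eq_or_lt with rfl | hlt
  · exact sumBound_self (by positivity)
  have hts : 0 < t - s := by linarith
  rcases hD.eq_or_lt with rfl | hDpos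
  · exact (sumBound_zero_of_forall hF hτ hFs (Or.inr rfl)).mono (by positivity)
  rcases hτ.eq_or_lt with rfl | hlt'
  · refine absurd ?_ hx
    rw [sub_self, enorm_zero, ENNReal.zero_rpow_of_neg (y := -(θ + η) - ζ) (by linarith),
      ENNReal.top_mul, ENNReal.mul_top]
    · refine mul_ne_zero ?_ ?_
      · rw [enorm_rpow_eq hD (Or.inl hDpos)]
        simp only [ne_eq, ENNReal.ofReal_eq_zero, not_le]
        positivity
      · rcases hζϑ.eq_or_lt with rfl | h
        · simp
        · rw [ENNReal.zero_rpow_of_neg (by linarith)]; simp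
    · rw [enorm_rpow_eq hts.le (Or.inl hts)]
      simp only [ne_eq, ENNReal.ofReal_eq_zero, not_le]
      positivity
  have hy : 0 < τ - t := by linarith
  refine ((hF ϑ ⟨by linarith, hϑ⟩).sumBound_regular hα hθ.le hβ (by linarith) hlt' hFs).mono ?_
  rw [enorm_rpow_eq hy.le (Or.inl hy), enorm_rpow_eq hy.le (Or.inl hy),
    enorm_rpow_eq hts.le (Or.inl hts), enorm_rpow_eq hD (Or.inl hDpos)]
  simp only [ENNReal.toReal_mul]
  rw [ENNReal.toReal_ofReal (by positivity), ENNReal.toReal_ofReal (by positivity),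
    ENNReal.toReal_ofReal (by positivity), ENNReal.toReal_ofReal (by positivity)]
  have e : (τ - t) ^ (-θ - (η + ϑ)) = (τ - t) ^ (-ϑ + ζ) * (τ - t) ^ (-(θ + η) - ζ) := by
    rw [← Real.rpow_add hy]; congr 1; ring
  have hc := sewConst_le_totalConst (η := η) hβ
  calc _ = sewConst (θ + α) * (N.toReal * (D ^ ϑ * (τ - t) ^ (-ϑ + ζ) *
        ((τ - t) ^ (-(θ + η) - ζ) * (t - s) ^ (θ + α)))) := by rw [e]; ring
    _ ≤ totalConst θ α η * (N.toReal * (D ^ ϑ * (τ - t) ^ (-ϑ + ζ) *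
        ((τ - t) ^ (-(θ + η) - ζ) * (t - s) ^ (θ + α)))) := by gcongr
    _ = _ := by ring

/-- The bound for rectangular increments of a kernel in terms of `τ - s`; only the exponents
`ν = 0` and `ν = 1` are used, so the constant does not depend on `ζ` and `ϑ`. -/
lemma sumBoundE_singular_of_forall (hF : ∀ ν ∈ Set.Icc (0 : ℝ) 1,
      SingIncr F s τ (η + ν) θ (N.toReal * D ^ ν))
    (hα : 0 ≤ α) (hα1 : α < 1) (hη : 0 ≤ η) (hθ : 0 < θ) (hβ : 1 < θ + α) (hηα : η < α)
    (hst : s ≤ t) (hτ : t ≤ τ) (hFs : F s = 0) (hD : 0 ≤ D) (hζ0 : 0 ≤ ζ) (hζ : ζ ≤ α - η)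
    (hζϑ : ζ ≤ ϑ) (hϑ : ϑ ≤ 1) :
    SumBoundE F α s t (totalConst θ α η * N *
      (‖D‖ₑ ^ ϑ * ‖τ - t‖ₑ ^ (-ϑ + ζ) * ‖τ - s‖ₑ ^ (θ + α - (θ + η) - ζ))) := by
  refine sumBoundE_mul (totalConst_pos hβ)
    (fun h => sumBound_zero_of_forall hF hτ hFs (Or.inl h)) (fun hx => ?_)
  rcases hst.eq_or_lt with rfl | hlt
  · exact sumBound_self (by positivity)
  have hL : 0 < τ - s := by linarith
  rcases hD.eq_or_lt with rfl | hDpos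
  · exact (sumBound_zero_of_forall hF hτ hFs (Or.inr rfl)).mono (by positivity)
  have hy : 0 ≤ τ - t := by linarith
  have hsing : t < τ ∨ ϑ = ζ := by
    by_contra! hcon
    obtain ⟨h1, h2⟩ := hcon
    obtain rfl : τ = t := le_antisymm h1 hτ
    have hlt2 : ζ < ϑ := lt_of_le_of_ne hζϑ h2.symm
    refine hx ?_
    rw [sub_self, enorm_zero, ENNReal.zero_rpow_of_neg (by linarith), ENNReal.mul_top,
      ENNReal.top_mul]
    · rw [enorm_rpow_eq hL.le (Or.inl hL)]
      simp only [ne_eq, ENNReal.ofReal_eq_zero, not_le]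
      positivity
    · rw [enorm_rpow_eq hD (Or.inl hDpos)]
      simp only [ne_eq, ENNReal.ofReal_eq_zero, not_le]
      positivity
  have h0 := hF 0 (by norm_num)
  rw [add_zero, Real.rpow_zero, mul_one] at h0
  have h1 := hF 1 (by norm_num)
  rw [Real.rpow_one] at h1
  refine (h0.sumBound_interp h1 hα hα1 hη hθ.le hβ hηα hst hτ hD hFs hζ0 hζ hζϑ hϑ hsing).mono ?_
  rw [add_sub_add_left_eq_sub, enorm_rpow_eq hy (hsing.imp (fun h => by linarith)
      (fun h => by rw [h, neg_add_cancel])),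
    enorm_rpow_eq hL.le (Or.inl hL), enorm_rpow_eq hD (Or.inl hDpos)]
  simp only [ENNReal.toReal_mul]
  rw [ENNReal.toReal_ofReal (by positivity), ENNReal.toReal_ofReal (by positivity),
    ENNReal.toReal_ofReal (by positivity)]
  gcongr
  exact singConst_le_totalConst hβ

end Extended

/-! ### Double integrals bounded by products, kernels and covariances -/

section Kernel

variable {𝕜 H : Type*} [RCLike 𝕜] [NormedAddCommGroup H] [InnerProductSpace 𝕜 H]

/-- One-dimensional bounds multiply, including the case of a product `0 * ∞ = 0`. -/
lemma HasDoubleIntegral.enorm_le {F G : ℝ → H →L[𝕜] H} {Q : ℝ → ℝ → H →L[𝕜] H}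
    {α s t s' t' : ℝ} {J : H →L[𝕜] H} {N B B' : ℝ≥0∞}
    (h : HasDoubleIntegral F Q G s t s' t' J) (hst : s ≤ t) (hst' : s' ≤ t') (hN : N ≠ ∞)
    (hQ : RectHolder Q α N.toReal s t s' t')
    (hF : YoungIntegrable (fun r => leftComp (F r)) α s t)
    (hG : YoungIntegrable (fun r => rightComp (G r)) α s' t')
    (hB : SumBoundE (fun r => leftComp (F r)) α s t B)
    (hB' : SumBoundE (fun r => rightComp (G r)) α s' t' B') : ‖J‖ₑ ≤ B * B' * N := by
  have key : ∀ b b' : ℝ≥0, SumBound (fun r => leftComp (F r)) α s t b →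
      SumBound (fun r => rightComp (G r)) α s' t' b' → ‖J‖ₑ ≤ b * b' * N := by
    intro b b' hb hb'
    have h1 := h.norm_le hst hst'
      (norm_riemannSum_le hQ ENNReal.toReal_nonneg b'.coe_nonneg hb hb')
    rw [← ofReal_norm]
    refine (ENNReal.ofReal_le_ofReal h1).trans_eq ?_
    rw [ENNReal.ofReal_mul b.coe_nonneg, ENNReal.ofReal_mul b'.coe_nonneg,
      ENNReal.ofReal_coe_nnreal,
      ENNReal.ofReal_coe_nnreal, ENNReal.ofReal_toReal hN, mul_assoc]
  -- finite bounds, used when one factor on the right is `0` and another one is `∞`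
  obtain ⟨⟨b₀, hb₀, hFb⟩, -⟩ := hF
  obtain ⟨⟨b₀', hb₀', hGb⟩, -⟩ := hG
  lift b₀ to ℝ≥0 using hb₀
  lift b₀' to ℝ≥0 using hb₀'
  by_cases hN0 : N = 0
  · simpa [hN0] using key b₀ b₀' hFb hGb
  by_cases hBt : B = ∞
  · by_cases hB0 : B' = 0
    · simpa [hB0] using key b₀ 0 hFb (hB' 0 (by simp [hB0]))
    · rw [hBt, ENNReal.top_mul hB0, ENNReal.top_mul hN0]; exact le_top
  by_cases hBt' : B' = ∞
  · by_cases hB0 : B = 0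
    · simpa [hB0] using key 0 b₀' (hB 0 (by simp [hB0])) hGb
    · rw [hBt', ENNReal.mul_top hB0, ENNReal.top_mul hN0]; exact le_top
  lift B to ℝ≥0 using hBt
  lift B' to ℝ≥0 using hBt'
  exact key B B' (hB B le_rfl) (hB' B' le_rfl)

lemma norm_le_of_enorm_div_le {V : Type*} [SeminormedAddCommGroup V] {x : V} {N : ℝ≥0∞} {d : ℝ}
    (hN : N ≠ ∞) (hd : 0 ≤ d) (h : ‖x‖ₑ / ENNReal.ofReal d ≤ N) : ‖x‖ ≤ N.toReal * d := by
  rw [ENNReal.div_le_iff_le_mul (Or.inr hN) (Or.inl ENNReal.ofReal_ne_top)] at h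
  have := ENNReal.toReal_mono (ENNReal.mul_ne_top hN ENNReal.ofReal_ne_top) h
  rwa [toReal_enorm, ENNReal.toReal_mul, ENNReal.toReal_ofReal hd] at this

variable {T η α : ℝ} {K Q : ℝ → ℝ → H →L[𝕜] H}

lemma IsVolterraKernel.norm_sub_le (hK : IsVolterraKernel T η K) {t u s θ : ℝ}
    (h : Simplex3 T t u s) (hut : u < t) (hθ : θ ∈ Set.Icc (0 : ℝ) 1) :
    ‖K t u - K t s‖ ≤ (kernelNorm T η K).toReal * ((u - s) ^ θ * (t - u) ^ (-θ - η)) := by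
  obtain ⟨h1, h2, h3, h4⟩ := id h
  have hus : 0 ≤ u - s := by linarith
  have htu : 0 < t - u := by linarith
  refine norm_le_of_enorm_div_le hK.ne (by positivity) ?_
  have hle : kernelNorm3 T η K ≤ kernelNorm T η K :=
    (le_add_self).trans le_self_add
  refine le_trans ?_ hle
  rw [ENNReal.ofReal_mul (by positivity), ← enorm_rpow_eq hus (Or.inr hθ.1),
    ← enorm_rpow_eq htu.le (Or.inl htu), kernelNorm3]
  exact le_iSup_of_le t <| le_iSup_of_le u <| le_iSup_of_le s <| le_iSup_of_le h <|
    le_iSup_of_le θ <| le_iSup_of_le hθ le_rfl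

lemma IsVolterraKernel.norm_rect_le (hK : IsVolterraKernel T η K) {τ₁ τ₂ m a θ ν : ℝ}
    (h : Simplex4 T τ₁ τ₂ m a) (hm : m < τ₂) (hθ : θ ∈ Set.Icc (0 : ℝ) 1)
    (hν : ν ∈ Set.Icc (0 : ℝ) 1) :
    ‖K τ₁ m - K τ₁ a - K τ₂ m + K τ₂ a‖ ≤ (kernelNorm T η K).toReal *
      ((τ₂ - m) ^ (-ν - θ - η) * (τ₁ - τ₂) ^ ν * (m - a) ^ θ) := by
  obtain ⟨h1, h2, h3, h4, h5⟩ := id h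
  have hma : 0 ≤ m - a := by linarith
  have hτm : 0 < τ₂ - m := by linarith
  have hτ : 0 ≤ τ₁ - τ₂ := by linarith
  refine norm_le_of_enorm_div_le hK.ne (by positivity) ?_
  have hle : kernelNorm4 T η K ≤ kernelNorm T η K := le_add_self
  refine le_trans ?_ hle
  rw [ENNReal.ofReal_mul (by positivity), ENNReal.ofReal_mul (by positivity),
    ← enorm_rpow_eq hma (Or.inr hθ.1), ← enorm_rpow_eq hτ (Or.inr hν.1),
    ← enorm_rpow_eq hτm.le (Or.inl hτm), kernelNorm4]
  exact le_iSup_of_le τ₁ <| le_iSup_of_le τ₂ <| le_iSup_of_le m <| le_iSup_of_le a <|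
    le_iSup_of_le h <| le_iSup_of_le θ <| le_iSup_of_le hθ <| le_iSup_of_le ν <|
    le_iSup_of_le hν le_rfl

lemma IsRegularCov.rectHolder (hQ : IsRegularCov T α Q) (hα : 0 ≤ α) {s t s' t' : ℝ} (hs : 0 ≤ s)
    (ht : t ≤ T) (hs' : 0 ≤ s') (ht' : t' ≤ T) :
    RectHolder Q α (covNorm T α Q).toReal s t s' t' := by
  intro a b a' b' ha hab hb ha' hab' hb'
  have hba : 0 ≤ b - a := by linarith
  have hba' : 0 ≤ b' - a' := by linarith
  rw [← Real.mul_rpow hba hba']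
  refine norm_le_of_enorm_div_le hQ.ne (by positivity) ?_
  have hle : covNorm11 T α Q ≤ covNorm T α Q := le_add_self
  refine le_trans ?_ hle
  rw [← enorm_rpow_eq (by positivity) (Or.inr hα), enorm_mul, covNorm11]
  exact le_iSup_of_le b <| le_iSup_of_le a <|
    le_iSup_of_le ⟨by linarith, hab, by linarith⟩ <| le_iSup_of_le b' <| le_iSup_of_le a' <|
    le_iSup_of_le ⟨by linarith, hab', by linarith⟩ le_rfl

lemma IsVolterraKernel.singIncr (hK : IsVolterraKernel T η K) {s τ θ : ℝ} (hs : 0 ≤ s)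
    (hτ : τ ≤ T) (hθ : θ ∈ Set.Icc (0 : ℝ) 1) :
    SingIncr (K τ) s τ η θ (kernelNorm T η K).toReal := by
  refine ⟨ENNReal.toReal_nonneg, fun a m ha ham hm => ?_, fun a m ha ham hm => ?_⟩
  · have h := hK.norm_sub_le (t := τ) (u := m) (s := a) (θ := 0)
      ⟨hs.trans ha, ham, hm.le, hτ⟩ hm (by norm_num)
    simpa using h
  · have h := hK.norm_sub_le (t := τ) (u := m) (s := a) ⟨hs.trans ha, ham, hm.le, hτ⟩ hm hθ
    rwa [← mul_assoc] at h

lemma IsVolterraKernel.singIncr_sub (hK : IsVolterraKernel T η K) {s τ θ : ℝ} (hs : 0 ≤ s)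
    (hτ : τ ≤ T) (hθ : θ ∈ Set.Icc (0 : ℝ) 1) :
    SingIncr (fun r => K τ r - K τ s) s τ η θ (kernelNorm T η K).toReal :=
  (hK.singIncr hs hτ hθ).of_norm_le fun a m => by rw [sub_sub_sub_cancel_right]

lemma IsVolterraKernel.singIncr_rectInc (hK : IsVolterraKernel T η K) {s τ₁ τ₂ θ ν : ℝ}
    (hs : 0 ≤ s) (hτ : τ₂ ≤ τ₁) (hτ₁ : τ₁ ≤ T) (hθ : θ ∈ Set.Icc (0 : ℝ) 1)
    (hν : ν ∈ Set.Icc (0 : ℝ) 1) :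
    SingIncr (fun r => rectInc K τ₂ s τ₁ r) s τ₂ (η + ν) θ
      ((kernelNorm T η K).toReal * (τ₁ - τ₂) ^ ν) := by
  have e : ∀ a m, rectInc K τ₂ s τ₁ m - rectInc K τ₂ s τ₁ a =
      K τ₁ m - K τ₁ a - K τ₂ m + K τ₂ a := by
    intro a m; simp only [rectInc]; abel
  refine ⟨mul_nonneg ENNReal.toReal_nonneg (Real.rpow_nonneg (by linarith) _),
    fun a m ha ham hm => ?_, fun a m ha ham hm => ?_⟩
  · have h := hK.norm_rect_le (θ := 0) ⟨hs.trans ha, ham, hm.le, hτ, hτ₁⟩ hm (by norm_num) hν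
    rw [e]
    refine h.trans_eq ?_
    rw [Real.rpow_zero, mul_one, sub_zero, neg_add_rev, ← sub_eq_add_neg]
    ring
  · have h := hK.norm_rect_le ⟨hs.trans ha, ham, hm.le, hτ, hτ₁⟩ hm hθ hν
    rw [e]
    refine h.trans_eq ?_
    rw [show -ν - θ - η = -θ - (η + ν) by ring]
    ring

variable [CompleteSpace H]

lemma norm_adjoint_sub_adjoint (A B : H →L[𝕜] H) :
    ‖ContinuousLinearMap.adjoint A - ContinuousLinearMap.adjoint B‖ = ‖A - B‖ := by
  rw [← map_sub, LinearIsometryEquiv.norm_map]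

lemma rectInc_adjKernel (K : ℝ → ℝ → H →L[𝕜] H) (s₁ s₂ t₁ t₂ : ℝ) :
    rectInc (adjKernel K) s₁ s₂ t₁ t₂ = ContinuousLinearMap.adjoint (rectInc K s₁ s₂ t₁ t₂) := by
  simp only [rectInc, adjKernel, map_sub, map_add]

lemma IsVolterraKernel.singIncr_adjKernel_sub (hK : IsVolterraKernel T η K) {s τ θ : ℝ}
    (hs : 0 ≤ s) (hτ : τ ≤ T) (hθ : θ ∈ Set.Icc (0 : ℝ) 1) :
    SingIncr (fun r => adjKernel K τ r - adjKernel K τ s) s τ η θ (kernelNorm T η K).toReal :=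
  (hK.singIncr hs hτ hθ).of_norm_le fun a m => by
    rw [sub_sub_sub_cancel_right]; exact (norm_adjoint_sub_adjoint _ _).le

lemma IsVolterraKernel.singIncr_adjKernel (hK : IsVolterraKernel T η K) {s τ θ : ℝ} (hs : 0 ≤ s)
    (hτ : τ ≤ T) (hθ : θ ∈ Set.Icc (0 : ℝ) 1) :
    SingIncr (adjKernel K τ) s τ η θ (kernelNorm T η K).toReal :=
  (hK.singIncr hs hτ hθ).of_norm_le fun _ _ => (norm_adjoint_sub_adjoint _ _).le

lemma IsVolterraKernel.singIncr_rectInc_adjKernel (hK : IsVolterraKernel T η K)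
    {s τ₁ τ₂ θ ν : ℝ} (hs : 0 ≤ s) (hτ : τ₂ ≤ τ₁) (hτ₁ : τ₁ ≤ T) (hθ : θ ∈ Set.Icc (0 : ℝ) 1)
    (hν : ν ∈ Set.Icc (0 : ℝ) 1) :
    SingIncr (fun r => rectInc (adjKernel K) τ₂ s τ₁ r) s τ₂ (η + ν) θ
      ((kernelNorm T η K).toReal * (τ₁ - τ₂) ^ ν) :=
  (hK.singIncr_rectInc hs hτ hτ₁ hθ hν).of_norm_le fun a m => by
    rw [rectInc_adjKernel, rectInc_adjKernel]; exact (norm_adjoint_sub_adjoint _ _).le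

end Kernel

/-! ### The Volterra double integral -/

section Integral

variable {𝕜 H : Type*} [RCLike 𝕜] [NormedAddCommGroup H] [InnerProductSpace 𝕜 H]

lemma SingIncr.leftComp {F : ℝ → H →L[𝕜] H} {s τ γ θ A : ℝ} (hF : SingIncr F s τ γ θ A) :
    SingIncr (fun r => leftComp (F r)) s τ γ θ A :=
  hF.of_norm_le fun _ _ => norm_leftComp_sub_le _ _

lemma SingIncr.rightComp {F : ℝ → H →L[𝕜] H} {s τ γ θ A : ℝ} (hF : SingIncr F s τ γ θ A) :
    SingIncr (fun r => rightComp (F r)) s τ γ θ A :=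
  hF.of_norm_le fun _ _ => norm_rightComp_sub_le _ _

lemma leftComp_zero : leftComp (0 : H →L[𝕜] H) = 0 := map_zero _

lemma rightComp_zero : rightComp (0 : H →L[𝕜] H) = 0 := map_zero _

lemma rectInc_self {V : Type*} [AddCommGroup V] (f : ℝ → ℝ → V) (s₁ s₂ t₁ : ℝ) :
    rectInc f s₁ s₂ t₁ s₂ = 0 := by
  rw [rectInc]; abel

/-- Two functions with singular increments of exponent `η < α` have a double integral against an
`α`-regular `Q`, bounded by the product of any two one-dimensional bounds. -/
lemma IsRegularCov.exists_integral [CompleteSpace H] {T α η θ s t τ s' t' τ' A A' : ℝ}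
    {Q : ℝ → ℝ → H →L[𝕜] H} {F G : ℝ → H →L[𝕜] H} (hQ : IsRegularCov T α Q)
    (hF : SingIncr F s τ η θ A) (hG : SingIncr G s' τ' η θ A') (hα : 0 ≤ α) (hη : 0 ≤ η)
    (hθ : 0 < θ) (hβ : 1 < θ + α) (hηα : η < α) (h : Simplex3 T τ t s)
    (h' : Simplex3 T τ' t' s') :
    ∃ J, HasDoubleIntegral F Q G s t s' t' J ∧ ∀ B B' : ℝ≥0∞,
      SumBoundE (fun r => VolterraSewing.leftComp (F r)) α s t B →
      SumBoundE (fun r => VolterraSewing.rightComp (G r)) α s' t' B' →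
        ‖J‖ₑ ≤ B * B' * covNorm T α Q := by
  obtain ⟨h1, h2, h3, h4⟩ := h
  obtain ⟨h1', h2', h3', h4'⟩ := h'
  have hR := hQ.rectHolder hα h1 (h3.trans h4) h1' (h3'.trans h4')
  have hFY := hF.leftComp.youngIntegrable hα hθ.le hβ (by linarith) h3 hηα
  have hGY := hG.rightComp.youngIntegrable hα hθ.le hβ (by linarith) h3' hηα
  obtain ⟨J, hJ⟩ := exists_hasDoubleIntegral h2 h2' hR ENNReal.toReal_nonneg hFY hGY
  exact ⟨J, hJ, fun B B' hB hB' => hJ.enorm_le h2 h2' hQ.ne hR hFY hGY hB hB'⟩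

end Integral

end VolterraSewing

open VolterraSewing in
theorem theorem4p3 {𝕜 H : Type*} [RCLike 𝕜] [NormedAddCommGroup H] [InnerProductSpace 𝕜 H]
    [CompleteSpace H] (T α η : ℝ) (hT : 0 < T) (hα : α ∈ Set.Ioo (0 : ℝ) 1)
    (hη : η ∈ Set.Ico (0 : ℝ) 1) (hαη : η < α) :
    ∃ (β κ : ℝ) (C : ℝ≥0), 1 < β ∧ 0 ≤ κ ∧ κ < 1 ∧ α - η ≤ β - κ ∧ 0 < C ∧
    ∀ K Q : ℝ → ℝ → H →L[𝕜] H,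
      VolterraSewing.IsVolterraKernel T η K → VolterraSewing.IsRegularCov T α Q →
      -- the integral `𝓘 τ τ' t t'` is the unique limit of the Riemann sums over `[0,t] × [0,t']`
      (∃ 𝓘 : ℝ → ℝ → ℝ → ℝ → H →L[𝕜] H,
        (∀ τ t τ' t' : ℝ, VolterraSewing.Simplex2 T τ t → VolterraSewing.Simplex2 T τ' t' →
          VolterraSewing.HasDoubleIntegral (K τ) Q (VolterraSewing.adjKernel K τ') 0 t 0 t'
            (𝓘 τ τ' t t') ∧
          ∀ J : H →L[𝕜] H,
            VolterraSewing.HasDoubleIntegral (K τ) Q (VolterraSewing.adjKernel K τ') 0 t 0 t' J →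
              J = 𝓘 τ τ' t t') ∧
        -- additivity over rectangles
        (∀ τ v u τ' v' u' : ℝ,
          VolterraSewing.Simplex3 T τ v u → VolterraSewing.Simplex3 T τ' v' u' →
          VolterraSewing.HasDoubleIntegral (K τ) Q (VolterraSewing.adjKernel K τ') u v u' v'
            (VolterraSewing.rectInc (𝓘 τ τ') u u' v v'))) ∧
      -- (i)
      (∀ τ t s τ' t' s' : ℝ,
        VolterraSewing.Simplex3 T τ t s → VolterraSewing.Simplex3 T τ' t' s' →
        ∃ J : H →L[𝕜] H,
          VolterraSewing.HasDoubleIntegral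
            (fun r => K τ r - K τ s) Q
            (fun r' => VolterraSewing.adjKernel K τ' r' - VolterraSewing.adjKernel K τ' s')
            s t s' t' J ∧
          ‖J‖ₑ ≤ C * VolterraSewing.kernelNorm T η K ^ 2 * VolterraSewing.covNorm T α Q *
            min ((‖τ - t‖ₑ * ‖τ' - t'‖ₑ) ^ (-κ) * (‖t - s‖ₑ * ‖t' - s'‖ₑ) ^ β)
              ((‖τ - s‖ₑ * ‖τ' - s'‖ₑ) ^ (β - κ))) ∧
      -- (ii)
      (∀ τ t s τ₁' τ₂' t' s' : ℝ,
        VolterraSewing.Simplex3 T τ t s → VolterraSewing.Simplex4 T τ₁' τ₂' t' s' →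
        ∃ J : H →L[𝕜] H,
          VolterraSewing.HasDoubleIntegral
            (fun r => K τ r - K τ s) Q
            (fun r' => VolterraSewing.rectInc (VolterraSewing.adjKernel K) τ₂' s' τ₁' r')
            s t s' t' J ∧
          ∀ ζ θ : ℝ, 0 ≤ ζ → ζ < α - η → ζ ≤ θ → θ ≤ 1 →
          ‖J‖ₑ ≤ C * VolterraSewing.kernelNorm T η K ^ 2 * VolterraSewing.covNorm T α Q *
            ‖τ₁' - τ₂'‖ₑ ^ θ * ‖τ₂' - t'‖ₑ ^ (-θ + ζ) *
            min (‖τ - t‖ₑ ^ (-κ) * ‖τ₂' - t'‖ₑ ^ (-κ - ζ) * (‖t - s‖ₑ * ‖t' - s'‖ₑ) ^ β)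
              (‖τ - s‖ₑ ^ (β - κ) * ‖τ₂' - s'‖ₑ ^ (β - κ - ζ))) ∧
      -- (iii)
      (∀ τ₁ τ₂ t s τ' t' s' : ℝ,
        VolterraSewing.Simplex4 T τ₁ τ₂ t s → VolterraSewing.Simplex3 T τ' t' s' →
        ∃ J : H →L[𝕜] H,
          VolterraSewing.HasDoubleIntegral
            (fun r => VolterraSewing.rectInc K τ₂ s τ₁ r) Q
            (fun r' => VolterraSewing.adjKernel K τ' r' - VolterraSewing.adjKernel K τ' s')
            s t s' t' J ∧
          ∀ ζ θ : ℝ, 0 ≤ ζ → ζ < α - η → ζ ≤ θ → θ ≤ 1 →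
          ‖J‖ₑ ≤ C * VolterraSewing.kernelNorm T η K ^ 2 * VolterraSewing.covNorm T α Q *
            ‖τ₁ - τ₂‖ₑ ^ θ * ‖τ₂ - t‖ₑ ^ (-θ + ζ) *
            min (‖τ₂ - t‖ₑ ^ (-κ - ζ) * ‖τ' - t'‖ₑ ^ (-κ) * (‖t - s‖ₑ * ‖t' - s'‖ₑ) ^ β)
              (‖τ₂ - s‖ₑ ^ (β - κ - ζ) * ‖τ' - s'‖ₑ ^ (β - κ))) ∧
      -- (iv)
      (∀ τ₁ τ₂ t s τ₁' τ₂' t' s' : ℝ,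
        VolterraSewing.Simplex4 T τ₁ τ₂ t s → VolterraSewing.Simplex4 T τ₁' τ₂' t' s' →
        ∃ J : H →L[𝕜] H,
          VolterraSewing.HasDoubleIntegral
            (fun r => VolterraSewing.rectInc K τ₂ s τ₁ r) Q
            (fun r' => VolterraSewing.rectInc (VolterraSewing.adjKernel K) τ₂' s' τ₁' r')
            s t s' t' J ∧
          ∀ ζ θ : ℝ, 0 ≤ ζ → ζ < α - η → ζ ≤ θ → θ ≤ 1 →
          ‖J‖ₑ ≤ C * VolterraSewing.kernelNorm T η K ^ 2 * VolterraSewing.covNorm T α Q *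
            (‖τ₁ - τ₂‖ₑ * ‖τ₁' - τ₂'‖ₑ) ^ θ * (‖τ₂ - t‖ₑ * ‖τ₂' - t'‖ₑ) ^ (-θ + ζ) *
            min ((‖τ₂ - t‖ₑ * ‖τ₂' - t'‖ₑ) ^ (-κ - ζ) * (‖t - s‖ₑ * ‖t' - s'‖ₑ) ^ β)
              ((‖τ₂ - s‖ₑ * ‖τ₂' - s'‖ₑ) ^ (β - κ - ζ))) := by
  obtain ⟨hα0, hα1⟩ := hα
  obtain ⟨hη0, hη1⟩ := hη
  -- any `θ₀` with `1 - α < θ₀ < 1 - η` serves as the Hölder exponent of the kernel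
  obtain ⟨θ₀, hθ₀, hθ₁, hβ, hκ⟩ : ∃ θ₀ : ℝ, 0 < θ₀ ∧ θ₀ ≤ 1 ∧ 1 < θ₀ + α ∧ θ₀ + η < 1 :=
    ⟨1 - (α + η) / 2, by linarith, by linarith, by linarith, by linarith⟩
  have hθm : θ₀ ∈ Set.Icc (0 : ℝ) 1 := ⟨hθ₀.le, hθ₁⟩
  set c := totalConst θ₀ α η with hc
  have hcpos : 0 < c := totalConst_pos hβ
  refine ⟨θ₀ + α, θ₀ + η, c ^ 2, hβ, by linarith, hκ, by linarith, by positivity, ?_⟩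
  intro K Q hK hQ
  have hmul : ∀ (x y p : ℝ), (‖x‖ₑ * ‖y‖ₑ) ^ p = ‖x‖ₑ ^ p * ‖y‖ₑ ^ p := fun x y p =>
    ENNReal.mul_rpow_of_ne_top enorm_ne_top enorm_ne_top p
  have hRI : ∀ {s τ₁ τ₂ : ℝ}, 0 ≤ s → τ₂ ≤ τ₁ → τ₁ ≤ T →
      SingIncr (fun r => rectInc K τ₂ s τ₁ r) s τ₂ η θ₀ (kernelNorm T η K).toReal := by
    intro s τ₁ τ₂ h1 h2 h3
    simpa using hK.singIncr_rectInc h1 h2 h3 hθm (ν := 0) (by norm_num)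
  have hRI' : ∀ {s τ₁ τ₂ : ℝ}, 0 ≤ s → τ₂ ≤ τ₁ → τ₁ ≤ T →
      SingIncr (fun r => rectInc (adjKernel K) τ₂ s τ₁ r) s τ₂ η θ₀
        (kernelNorm T η K).toReal := by
    intro s τ₁ τ₂ h1 h2 h3
    simpa using hK.singIncr_rectInc_adjKernel h1 h2 h3 hθm (ν := 0) (by norm_num)
  refine ⟨?_, ?_, ?_, ?_, ?_⟩
  · have hex : ∀ τ v u τ' v' u' : ℝ, Simplex3 T τ v u → Simplex3 T τ' v' u' →
        ∃ J, HasDoubleIntegral (K τ) Q (adjKernel K τ') u v u' v' J := by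
      intro τ v u τ' v' u' h h'
      obtain ⟨J, hJ, -⟩ := hQ.exists_integral (hK.singIncr h.1 h.2.2.2 hθm)
        (hK.singIncr_adjKernel h'.1 h'.2.2.2 hθm) hα0.le hη0 hθ₀ hβ hαη h h'
      exact ⟨J, hJ⟩
    have h0 : ∀ {τ t : ℝ}, Simplex2 T τ t → Simplex3 T τ t 0 := fun h => ⟨le_rfl, h⟩
    choose! 𝓘 h𝓘 using fun (τ τ' t t' : ℝ) (h : Simplex2 T τ t ∧ Simplex2 T τ' t') =>
      hex τ t 0 τ' t' 0 (h0 h.1) (h0 h.2)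
    refine ⟨𝓘, fun τ t τ' t' h h' => ⟨h𝓘 τ τ' t t' ⟨h, h'⟩, fun J hJ =>
      hJ.unique (h𝓘 τ τ' t t' ⟨h, h'⟩) h.1 h'.1⟩, ?_⟩
    intro τ v u τ' v' u' h h'
    obtain ⟨J, hJ⟩ := hex τ v u τ' v' u' h h'
    obtain ⟨hu, huv, hvτ, hτ⟩ := id h
    obtain ⟨hu', huv', hvτ', hτ'⟩ := id h'
    have hv2 : Simplex2 T τ v := ⟨hu.trans huv, hvτ, hτ⟩
    have hu2 : Simplex2 T τ u := ⟨hu, huv.trans hvτ, hτ⟩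
    have hv2' : Simplex2 T τ' v' := ⟨hu'.trans huv', hvτ', hτ'⟩
    have hu2' : Simplex2 T τ' u' := ⟨hu', huv'.trans hvτ', hτ'⟩
    have e1 := (h𝓘 τ τ' v v' ⟨hv2, hv2'⟩).eq_add_right (hu.trans huv) hu' huv'
      (h𝓘 τ τ' v u' ⟨hv2, hu2'⟩)
      (hex τ v 0 τ' v' u' (h0 hv2) h').choose_spec
    have e2 := (h𝓘 τ τ' u v' ⟨hu2, hv2'⟩).eq_add_right hu hu' huv'
      (h𝓘 τ τ' u u' ⟨hu2, hu2'⟩)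
      (hex τ u 0 τ' v' u' (h0 hu2) h').choose_spec
    have e3 := (hex τ v 0 τ' v' u' (h0 hv2) h').choose_spec.eq_add_left hu huv huv'
      (hex τ u 0 τ' v' u' (h0 hu2) h').choose_spec hJ
    have e : rectInc (𝓘 τ τ') u u' v v' = J := by
      rw [rectInc, e1, e2, e3]; abel
    rwa [e]
  · intro τ t s τ' t' s' h h'
    obtain ⟨J, hJ, hJb⟩ := hQ.exists_integral (hK.singIncr_sub h.1 h.2.2.2 hθm)
      (hK.singIncr_adjKernel_sub h'.1 h'.2.2.2 hθm) hα0.le hη0 hθ₀ hβ hαη h h'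
    refine ⟨J, hJ, ?_⟩
    obtain ⟨hs, hst, htτ, hτ⟩ := h
    obtain ⟨hs', hst', htτ', hτ'⟩ := h'
    have hF := (hK.singIncr_sub hs hτ hθm).leftComp
    have hG := (hK.singIncr_adjKernel_sub hs' hτ' hθm).rightComp
    have hF0 : leftComp (K τ s - K τ s) = 0 := by rw [sub_self, leftComp_zero]
    have hG0 : rightComp (adjKernel K τ' s' - adjKernel K τ' s') = 0 := by
      rw [sub_self, rightComp_zero]
    have b1 := hJb _ _ (hF.sumBoundE_regular hα0.le hη0 hθ₀ hβ hst htτ hF0)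
      (hG.sumBoundE_regular hα0.le hη0 hθ₀ hβ hst' htτ' hG0)
    have b2 := hJb _ _ (hF.sumBoundE_singular hα0.le hη0 hθ₀ hβ hαη hst htτ hF0)
      (hG.sumBoundE_singular hα0.le hη0 hθ₀ hβ hαη hst' htτ' hG0)
    rw [mul_min_of_nonneg _ _ zero_le]
    simp only [hmul, ENNReal.coe_pow]
    exact le_min (b1.trans_eq (by ring)) (b2.trans_eq (by ring))
  · intro τ t s τ₁' τ₂' t' s' h h'
    obtain ⟨hs, hst, htτ, hτ⟩ := id h
    obtain ⟨hs', hst', htτ', hτ', hT'⟩ := id h'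
    obtain ⟨J, hJ, hJb⟩ := hQ.exists_integral (hK.singIncr_sub hs hτ hθm)
      (hRI' hs' hτ' hT') hα0.le hη0 hθ₀ hβ hαη h ⟨hs', hst', htτ', hτ'.trans hT'⟩
    refine ⟨J, hJ, fun ζ ϑ hζ0 hζ hζϑ hϑ => ?_⟩
    have hF := (hK.singIncr_sub hs hτ hθm).leftComp
    have hG := fun ν hν =>
      (hK.singIncr_rectInc_adjKernel (ν := ν) hs' hτ' hT' hθm hν).rightComp
    have hF0 : leftComp (K τ s - K τ s) = 0 := by rw [sub_self, leftComp_zero]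
    have hG0 : rightComp (rectInc (adjKernel K) τ₂' s' τ₁' s') = 0 := by
      rw [rectInc_self, rightComp_zero]
    have b1 := hJb _ _ (hF.sumBoundE_regular hα0.le hη0 hθ₀ hβ hst htτ hF0)
      (sumBoundE_regular_of_forall hG hα0.le hη0 hθ₀ hβ hst' htτ' hG0 (sub_nonneg.2 hτ')
        hζ0 hζϑ hϑ)
    have b2 := hJb _ _ (hF.sumBoundE_singular hα0.le hη0 hθ₀ hβ hαη hst htτ hF0)
      (sumBoundE_singular_of_forall hG hα0.le hα1 hη0 hθ₀ hβ hαη hst' htτ' hG0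
        (sub_nonneg.2 hτ') hζ0 hζ.le hζϑ hϑ)
    rw [mul_min_of_nonneg _ _ zero_le]
    simp only [hmul, ENNReal.coe_pow]
    exact le_min (b1.trans_eq (by ring)) (b2.trans_eq (by ring))
  · intro τ₁ τ₂ t s τ' t' s' h h'
    obtain ⟨hs, hst, htτ, hτ, hT₁⟩ := id h
    obtain ⟨hs', hst', htτ', hτ'⟩ := id h'
    obtain ⟨J, hJ, hJb⟩ := hQ.exists_integral (hRI hs hτ hT₁)
      (hK.singIncr_adjKernel_sub hs' hτ' hθm) hα0.le hη0 hθ₀ hβ hαη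
      ⟨hs, hst, htτ, hτ.trans hT₁⟩ h'
    refine ⟨J, hJ, fun ζ ϑ hζ0 hζ hζϑ hϑ => ?_⟩
    have hF := fun ν hν => (hK.singIncr_rectInc (ν := ν) hs hτ hT₁ hθm hν).leftComp
    have hG := (hK.singIncr_adjKernel_sub hs' hτ' hθm).rightComp
    have hF0 : leftComp (rectInc K τ₂ s τ₁ s) = 0 := by rw [rectInc_self, leftComp_zero]
    have hG0 : rightComp (adjKernel K τ' s' - adjKernel K τ' s') = 0 := by
      rw [sub_self, rightComp_zero]
    have b1 := hJb _ _
      (sumBoundE_regular_of_forall hF hα0.le hη0 hθ₀ hβ hst htτ hF0 (sub_nonneg.2 hτ)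
        hζ0 hζϑ hϑ)
      (hG.sumBoundE_regular hα0.le hη0 hθ₀ hβ hst' htτ' hG0)
    have b2 := hJb _ _
      (sumBoundE_singular_of_forall hF hα0.le hα1 hη0 hθ₀ hβ hαη hst htτ hF0
        (sub_nonneg.2 hτ) hζ0 hζ.le hζϑ hϑ)
      (hG.sumBoundE_singular hα0.le hη0 hθ₀ hβ hαη hst' htτ' hG0)
    rw [mul_min_of_nonneg _ _ zero_le]
    simp only [hmul, ENNReal.coe_pow]
    exact le_min (b1.trans_eq (by ring)) (b2.trans_eq (by ring))
  · intro τ₁ τ₂ t s τ₁' τ₂' t' s' h h'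
    obtain ⟨hs, hst, htτ, hτ, hT₁⟩ := id h
    obtain ⟨hs', hst', htτ', hτ', hT'⟩ := id h'
    obtain ⟨J, hJ, hJb⟩ := hQ.exists_integral (hRI hs hτ hT₁) (hRI' hs' hτ' hT')
      hα0.le hη0 hθ₀ hβ hαη ⟨hs, hst, htτ, hτ.trans hT₁⟩ ⟨hs', hst', htτ', hτ'.trans hT'⟩
    refine ⟨J, hJ, fun ζ ϑ hζ0 hζ hζϑ hϑ => ?_⟩
    have hF := fun ν hν => (hK.singIncr_rectInc (ν := ν) hs hτ hT₁ hθm hν).leftComp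
    have hG := fun ν hν =>
      (hK.singIncr_rectInc_adjKernel (ν := ν) hs' hτ' hT' hθm hν).rightComp
    have hF0 : leftComp (rectInc K τ₂ s τ₁ s) = 0 := by rw [rectInc_self, leftComp_zero]
    have hG0 : rightComp (rectInc (adjKernel K) τ₂' s' τ₁' s') = 0 := by
      rw [rectInc_self, rightComp_zero]
    have b1 := hJb _ _
      (sumBoundE_regular_of_forall hF hα0.le hη0 hθ₀ hβ hst htτ hF0 (sub_nonneg.2 hτ)
        hζ0 hζϑ hϑ)
      (sumBoundE_regular_of_forall hG hα0.le hη0 hθ₀ hβ hst' htτ' hG0 (sub_nonneg.2 hτ')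
        hζ0 hζϑ hϑ)
    have b2 := hJb _ _
      (sumBoundE_singular_of_forall hF hα0.le hα1 hη0 hθ₀ hβ hαη hst htτ hF0
        (sub_nonneg.2 hτ) hζ0 hζ.le hζϑ hϑ)
      (sumBoundE_singular_of_forall hG hα0.le hα1 hη0 hθ₀ hβ hαη hst' htτ' hG0
        (sub_nonneg.2 hτ') hζ0 hζ.le hζϑ hϑ)
    rw [mul_min_of_nonneg _ _ zero_le]
    simp only [hmul, ENNReal.coe_pow]
    exact le_min (b1.trans_eq (by ring)) (b2.trans_eq (by ring))
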